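/- Throughout, $\otimes$ is the minimal tensor product of $C^*$-algebras. Let $N\ge 4$. Let $\mathcal C_N$ be the category whose objects are pairs $(D,M)$ of a $C^*$-algebra $D$ and a matrix $M=(m_{ij})\in M_N(D)$ whose entries generate $D$ as a $C^*$-algebra, and whose arrows $(D,M)\to(D',M')$ are the $*$-homomorphisms $\varphi:D\to D'$ with $\varphi(m_{ij})=m'_{ij}$ for all $i,j$ (there is at most one arrow between two objects). For matrices $X\in M_N(A)$ and $Y\in M_N(B)$ over $C^*$-algebras $A,B$ let $X⦶Y\in M_N(A\otimes B)$ be the matrix with entries $\sum_{k=1}^N x_{ik}\otimes y_{kj}$. Let $A=C^*(p,q,1)$ be the universal unital $C^*$-algebra generated by two projections $p,q$. For pairwise different $a,b,c,d\in\{1,\dots,N\}$ let $R_{(a,b),(c,d)}\in M_N(A)$ be the matrix with entries $p$ at $(a,a)$ and $(b,b)$, $q$ at $(c,c)$ and $(d,d)$, $1$ at all other diagonal positions, $1-p$ at $(a,b)$ and $(b,a)$, $1-q$ at $(c,d)$ and $(d,c)$, and $0$ at all other off-diagonal positions. Let $L\ge 1$ be an integer such that every permutation in $S_N$ is a product of at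 most $L$ transpositions. For each pair $a<b$ choose $c,d$ such that $a,b,c,d$ are pairwise different, and put $R_{(a,b),*}=R_{(a,b),(c,d)}$. Define $$M_1=\Big(\underset{1\le a<b\le N}{⦶} R_{(a,b),*}\Big)^{⦶ L},$$ the product over the pairs being taken in an arbitrary order, and let $B_1$ be the $C^*$-algebra generated by the entries of $M_1$. For $n\ge1$ let $M_n=M_1^{⦶ n}$, a matrix over $B_1^{\otimes n}$, and let $B_n\subseteq B_1^{\otimes n}$ be the $C^*$-algebra generated by the entries of $M_n$. **Theorem.** For every $n\ge 1$ there is a (unique) arrow $\pi_{n+1,n}:(B_{n+1},M_{n+1})\to(B_n,M_n)$ in $\mathcal C_N$, and the resulting inverse system has an inverse limit $(B_\infty,M_\infty)$, $M_\infty=(m_{ij})$, in $\mathcal C_N$. This limit is a compact matrix quantum group: $B_\infty$ is unital, $M_\infty$ is unitary, $(m_{ij}^*)_{i,j}$ is invertible, and there is a unital $*$-homomorphism $\Delta:B_\infty\to B_\infty\otimes B_\infty$ with $$\Delta(m_{ij})=\sum_{k=1}^N m_{ik}\otimes m_{kj}\qquad(1\le i,j\le N).$$ Moreover, this comultiplication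 $\Delta$ is isometric. -/

import Mathlib

open scoped ENNReal TensorProduct

noncomputable section

universe u v

/-! ## Generated C⋆-subalgebras -/

section Generated

variable {A : Type u} [NonUnitalCStarAlgebra A]

/-- The C⋆-subalgebra `C⋆(s)` of `A` generated by a set `s`: the norm closure of the (non-unital)
`*`-subalgebra generated by `s`. -/
def cstarGen (s : Set A) : NonUnitalStarSubalgebra ℂ A :=
  (NonUnitalStarAlgebra.adjoin ℂ s).topologicalClosure

instance cstarGen_isClosed (s : Set A) : IsClosed (cstarGen s : Set A) :=
  NonUnitalStarSubalgebra.isClosed_topologicalClosure _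

theorem mem_cstarGen {s : Set A} {x : A} (hx : x ∈ s) : x ∈ cstarGen s :=
  NonUnitalStarSubalgebra.le_topologicalClosure _ (NonUnitalStarAlgebra.subset_adjoin ℂ s hx)

/-- `C⋆(s)` as a C⋆-algebra of its own. -/
def CStarGen (s : Set A) : Type u := ↥(cstarGen s)

instance (s : Set A) : NonUnitalCStarAlgebra (CStarGen s) :=
  NonUnitalStarSubalgebra.nonUnitalCStarAlgebra (cstarGen s)

/-- The inclusion of `C⋆(s)` into `A`. -/
def CStarGen.incl (s : Set A) : CStarGen s →⋆ₙₐ[ℂ] A :=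
  NonUnitalStarSubalgebraClass.subtype (cstarGen s)

/-- An element of `s` as an element of `C⋆(s)`. -/
def CStarGen.of {s : Set A} (x : A) (hx : x ∈ s) : CStarGen s := ⟨x, mem_cstarGen hx⟩

/-- The generators of `C⋆(s)` also generate it as a C⋆-algebra of its own. -/
theorem cstarGen_eq_top (s : Set A) (t : Set (CStarGen s))
    (ht : ∀ x (hx : x ∈ s), CStarGen.of x hx ∈ t) : cstarGen t = ⊤ := by
  have key : ∀ x ∈ NonUnitalStarAlgebra.adjoin ℂ s,
      ∃ y ∈ NonUnitalStarAlgebra.adjoin ℂ t, CStarGen.incl s y = x := by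
    intro x hx
    induction hx using NonUnitalStarAlgebra.adjoin_induction with
    | mem x hx => exact ⟨CStarGen.of x hx, NonUnitalStarAlgebra.subset_adjoin ℂ _ (ht x hx), rfl⟩
    | add x y _ _ hx hy =>
      obtain ⟨a, ha, rfl⟩ := hx
      obtain ⟨b, hb, rfl⟩ := hy
      exact ⟨a + b, add_mem ha hb, map_add _ _ _⟩
    | zero => exact ⟨0, zero_mem _, map_zero _⟩
    | mul x y _ _ hx hy =>
      obtain ⟨a, ha, rfl⟩ := hx
      obtain ⟨b, hb, rfl⟩ := hy
      exact ⟨a * b, mul_mem ha hb, map_mul _ _ _⟩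
    | smul r x _ hx =>
      obtain ⟨a, ha, rfl⟩ := hx
      exact ⟨r • a, SMulMemClass.smul_mem r ha, map_smul _ _ _⟩
    | star x _ hx =>
      obtain ⟨a, ha, rfl⟩ := hx
      exact ⟨star a, star_mem ha, map_star _ _⟩
  have hind : Topology.IsInducing (CStarGen.incl s) := Topology.IsInducing.subtypeVal
  rw [eq_top_iff]
  intro x _
  change x ∈ closure (NonUnitalStarAlgebra.adjoin ℂ t : Set (CStarGen s))
  rw [hind.closure_eq_preimage_closure_image]
  have hx : CStarGen.incl s x ∈ closure (NonUnitalStarAlgebra.adjoin ℂ s : Set A) := x.2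
  refine closure_mono ?_ hx
  intro z hz
  obtain ⟨y, hy, rfl⟩ := key z hz
  exact ⟨y, hy, rfl⟩

end Generated

/-! ## The minimal tensor product -/

section GNS

attribute [local instance] CStarAlgebra.spectralOrder CStarAlgebra.spectralOrderedRing

open scoped ComplexOrder

/-- Positive linear functionals on a C⋆-algebra (with its usual order). -/
abbrev PosFunctional (A : Type u) [NonUnitalCStarAlgebra A] : Type u := A →ₚ[ℂ] ℂ

variable {A : Type u} [NonUnitalCStarAlgebra A]

/-- The Hilbert space of the GNS representation of a positive functional. -/
abbrev GNSSpace (f : PosFunctional A) : Type u := f.GNS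

/-- The GNS representation of a positive functional. -/
abbrev gnsRep (f : PosFunctional A) : A →⋆ₙₐ[ℂ] (GNSSpace f →L[ℂ] GNSSpace f) :=
  f.gnsNonUnitalStarAlgHom

end GNS

section MinTensor

variable {A : Type u} [NonUnitalCStarAlgebra A] {B : Type v} [NonUnitalCStarAlgebra B]

/-- The Hilbert space tensor product of two GNS spaces. -/
def GNSTensor (i : PosFunctional A × PosFunctional B) : Type (max u v) :=
  UniformSpace.Completion (GNSSpace i.1 ⊗[ℂ] GNSSpace i.2)

instance (i : PosFunctional A × PosFunctional B) : NormedAddCommGroup (GNSTensor i) :=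
  inferInstanceAs (NormedAddCommGroup (UniformSpace.Completion (GNSSpace i.1 ⊗[ℂ] GNSSpace i.2)))

instance (i : PosFunctional A × PosFunctional B) : InnerProductSpace ℂ (GNSTensor i) :=
  inferInstanceAs
    (InnerProductSpace ℂ (UniformSpace.Completion (GNSSpace i.1 ⊗[ℂ] GNSSpace i.2)))

instance (i : PosFunctional A × PosFunctional B) : CompleteSpace (GNSTensor i) :=
  inferInstanceAs (CompleteSpace (UniformSpace.Completion (GNSSpace i.1 ⊗[ℂ] GNSSpace i.2)))

/-- The operator `π_f(a) ⊗ π_g(b)` on the Hilbert space `H_f ⊗ H_g`. -/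
def gnsTensorOp (a : A) (b : B) (i : PosFunctional A × PosFunctional B) :
    GNSTensor i →L[ℂ] GNSTensor i :=
  (TensorProduct.mapL (gnsRep i.1 a) (gnsRep i.2 b)).completion

theorem norm_gnsTensorOp_le (a : A) (b : B) (i : PosFunctional A × PosFunctional B) :
    ‖gnsTensorOp a b i‖ ≤ ‖a‖ * ‖b‖ := by
  have hT : ‖TensorProduct.mapL (gnsRep i.1 a) (gnsRep i.2 b)‖ ≤ ‖a‖ * ‖b‖ := by
    refine (TensorProduct.norm_mapL_le _ _).trans ?_
    gcongr
    · exact NonUnitalStarAlgHom.norm_apply_le (gnsRep i.1) a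
    · exact NonUnitalStarAlgHom.norm_apply_le (gnsRep i.2) b
  have hc : ∀ x : UniformSpace.Completion (GNSSpace i.1 ⊗[ℂ] GNSSpace i.2),
      ‖(TensorProduct.mapL (gnsRep i.1 a) (gnsRep i.2 b)).completion x‖ ≤ ‖a‖ * ‖b‖ * ‖x‖ := by
    intro x
    induction x using UniformSpace.Completion.induction_on with
    | hp => exact isClosed_le (by fun_prop) (by fun_prop)
    | ih x =>
      rw [ContinuousLinearMap.completion_apply_coe, UniformSpace.Completion.norm_coe,
        UniformSpace.Completion.norm_coe]
      exact (ContinuousLinearMap.le_opNorm _ x).trans (by gcongr)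
  exact ContinuousLinearMap.opNorm_le_bound _ (by positivity) hc

/-- The C⋆-algebra of bounded families of operators on the Hilbert spaces `H_f ⊗ H_g`,
where `f` and `g` run through all positive functionals of `A` and `B`. -/
abbrev GNSTensorOps (A : Type u) [NonUnitalCStarAlgebra A] (B : Type v)
    [NonUnitalCStarAlgebra B] : Type (max u v) :=
  lp (fun i : PosFunctional A × PosFunctional B => GNSTensor i →L[ℂ] GNSTensor i) ∞

/-- The family `(π_f(a) ⊗ π_g(b))` indexed by all pairs `(f, g)`. -/
def elemTensor (a : A) (b : B) : GNSTensorOps A B :=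
  ⟨gnsTensorOp a b, memℓp_infty ⟨‖a‖ * ‖b‖, by
    rintro _ ⟨i, rfl⟩
    exact norm_gnsTensorOp_le a b i⟩⟩

/-- The minimal tensor product `A ⊗ B` of two C⋆-algebras: the completion of the algebraic
tensor product for the norm `sup ‖(ξ₁ ⊗ ξ₂)(x)‖` over all pairs of representations
`ξ₁` of `A` and `ξ₂` of `B` on Hilbert spaces. Since every representation is a direct sum of
cyclic representations and a null representation, and the cyclic ones are the GNS representations,
it suffices to let `ξ₁`, `ξ₂` run through the GNS representations of all positive functionals. -/
def MinTensor (A : Type u) [NonUnitalCStarAlgebra A] (B : Type v)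
    [NonUnitalCStarAlgebra B] : Type (max u v) :=
  CStarGen (Set.range fun x : A × B => elemTensor x.1 x.2)

instance (A : Type u) [NonUnitalCStarAlgebra A] (B : Type v) [NonUnitalCStarAlgebra B] :
    NonUnitalCStarAlgebra (MinTensor A B) :=
  inferInstanceAs (NonUnitalCStarAlgebra (CStarGen (Set.range fun x : A × B => elemTensor x.1 x.2)))

/-- The elementary tensor `a ⊗ b` in the minimal tensor product. -/
def minTmul (a : A) (b : B) : MinTensor A B :=
  CStarGen.of (elemTensor a b) ⟨(a, b), rfl⟩

end MinTensor

/-! ## The categories `𝒞_N` and compact matrix quantum groups -/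

/-- A C⋆-algebra together with an `N × N` matrix over it. -/
structure MatPair (N : ℕ) where
  carrier : Type u
  [cstar : NonUnitalCStarAlgebra carrier]
  mat : Matrix (Fin N) (Fin N) carrier

attribute [instance] MatPair.cstar

/-- The set of entries of the matrix. -/
def MatPair.entries {N : ℕ} (X : MatPair.{u} N) : Set X.carrier :=
  Set.range fun ij : Fin N × Fin N => X.mat ij.1 ij.2

/-- The objects `(D, M)` of the category `𝒞_N`: the C⋆-algebra `D` is generated by the entries
of the matrix `M`. -/
structure CatObj (N : ℕ) extends MatPair.{u} N where
  generated : cstarGen toMatPair.entries = ⊤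

/-- The arrows of `𝒞_N`: `*`-homomorphisms mapping the matrix entrywise to the matrix. -/
structure CatArrow {N : ℕ} (X : CatObj.{u} N) (Y : CatObj.{v} N) where
  hom : X.carrier →⋆ₙₐ[ℂ] Y.carrier
  map_mat : ∀ i j, hom (X.mat i j) = Y.mat i j

/-- There is at most one arrow between two objects of `𝒞_N`. -/
instance {N : ℕ} (X : CatObj.{u} N) (Y : CatObj.{v} N) : Subsingleton (CatArrow X Y) := by
  constructor
  rintro ⟨f, hf⟩ ⟨g, hg⟩
  have hadj : Set.EqOn f g (NonUnitalStarAlgebra.adjoin ℂ X.entries) := by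
    intro x hx
    induction hx using NonUnitalStarAlgebra.adjoin_induction with
    | mem x hx => obtain ⟨ij, rfl⟩ := hx; rw [hf, hg]
    | add x y _ _ hx hy => rw [map_add, map_add, hx, hy]
    | zero => rw [map_zero, map_zero]
    | mul x y _ _ hx hy => rw [map_mul, map_mul, hx, hy]
    | smul r x _ hx => rw [map_smul, map_smul, hx]
    | star x _ hx => rw [map_star, map_star, hx]
  have hcont : ∀ h : X.carrier →⋆ₙₐ[ℂ] Y.carrier, Continuous h := fun h =>
    AddMonoidHomClass.continuous_of_bound h 1 fun a => by
      simpa using NonUnitalStarAlgHom.norm_apply_le h a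
  have hall : f = g := by
    ext x
    have hx : x ∈ cstarGen X.entries := by rw [X.generated]; trivial
    exact hadj.closure (hcont f) (hcont g) hx
  subst hall
  rfl

/-- `(C⋆(m_ij), M)`, the object of `𝒞_N` obtained by passing to the C⋆-subalgebra generated by the
entries of the matrix. -/
def MatPair.generatedObj {N : ℕ} (X : MatPair.{u} N) : CatObj.{u} N where
  carrier := CStarGen X.entries
  mat := fun i j => CStarGen.of (X.mat i j) ⟨(i, j), rfl⟩
  generated := by
    refine cstarGen_eq_top _ _ ?_
    rintro _ ⟨ij, rfl⟩
    exact ⟨ij, rfl⟩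

/-- `e` is a unit element of the C⋆-algebra `A`. -/
def IsUnitElement {A : Type u} [NonUnitalCStarAlgebra A] (e : A) : Prop :=
  ∀ a : A, e * a = a ∧ a * e = a

/-- `Δ` is a comultiplication on `(A, u)`: a unital `*`-homomorphism into the minimal tensor
product `A ⊗ A` with `Δ(u_ij) = ∑ k, u_ik ⊗ u_kj`. -/
structure IsComultiplication {N : ℕ} (X : CatObj.{u} N)
    (Δ : X.carrier →⋆ₙₐ[ℂ] MinTensor X.carrier X.carrier) : Prop where
  map_unit : ∀ e : X.carrier, IsUnitElement e → IsUnitElement (Δ e)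
  map_mat : ∀ i j, Δ (X.mat i j) = ∑ k, minTmul (X.mat i k) (X.mat k j)

/-- The object `(A, u)` of `𝒞_N` is a compact matrix quantum group: `A` is unital, `u` is unitary,
the entrywise adjoint of `u` is invertible, and there is a comultiplication. -/
def IsCompactMatrixQuantumGroup {N : ℕ} (X : CatObj.{u} N) : Prop :=
  ∃ e : X.carrier, IsUnitElement e ∧
    X.mat * X.mat.conjTranspose = Matrix.diagonal (fun _ => e) ∧
    X.mat.conjTranspose * X.mat = Matrix.diagonal (fun _ => e) ∧
    (∃ V : Matrix (Fin N) (Fin N) X.carrier,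
      X.mat.map star * V = Matrix.diagonal (fun _ => e) ∧
      V * X.mat.map star = Matrix.diagonal (fun _ => e)) ∧
    ∃ Δ : X.carrier →⋆ₙₐ[ℂ] MinTensor X.carrier X.carrier, IsComultiplication X Δ

/-! ## Inverse limits in `𝒞_N` -/

/-- A cone in `𝒞_N` over the inverse system with objects `D n` and arrows `π n : D (n+1) → D n`. -/
structure CatCone {N : ℕ} {D : ℕ → CatObj.{u} N} (π : ∀ n, CatArrow (D (n + 1)) (D n)) where
  pt : CatObj.{u} N
  arrow : ∀ n, CatArrow pt (D n)
  comm : ∀ n a, (π n).hom ((arrow (n + 1)).hom a) = (arrow n).hom a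

/-- The cone is an inverse limit of the system: every other cone factors through it. The
factorization is unique since there is at most one arrow between two objects of `𝒞_N`. -/
def CatCone.IsInverseLimit {N : ℕ} {D : ℕ → CatObj.{u} N}
    {π : ∀ n, CatArrow (D (n + 1)) (D n)} (C : CatCone π) : Prop :=
  ∀ C' : CatCone π, ∃ ψ : CatArrow C'.pt C.pt,
    ∀ n a, (C.arrow n).hom (ψ.hom a) = (C'.arrow n).hom a

/-! ## The Woronowicz product -/

/-- The Woronowicz product `M₁ ⦶ M₂`, with entries `∑ k, m⁽¹⁾_ik ⊗ m⁽²⁾_kj` in `A ⊗ B`. -/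
def MatPair.wprod {N : ℕ} (X : MatPair.{u} N) (Y : MatPair.{v} N) : MatPair.{max u v} N where
  carrier := MinTensor X.carrier Y.carrier
  mat := fun i j => ∑ k, minTmul (X.mat i k) (Y.mat k j)

/-- The product `X₀ ⦶ X₁ ⦶ ⋯ ⦶ X_k` of a nonempty finite sequence, bracketed to the left. -/
def MatPair.wprodList {N : ℕ} (X₀ : MatPair.{u} N) (l : List (MatPair.{u} N)) : MatPair.{u} N :=
  l.foldl MatPair.wprod X₀

/-- The power `X ⦶ ⋯ ⦶ X` with `n ≥ 1` factors. -/
def MatPair.wpow {N : ℕ} (X : MatPair.{u} N) (n : ℕ+) : MatPair.{u} N :=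
  X.wprodList (List.replicate n.natPred X)

/-! ## The universal C⋆-algebra generated by two projections -/

/-- A representation of the generators and relations: projections `e, p, q` in a C⋆-algebra such
that `e p = p e = p` and `e q = q e = q`. -/
structure TwoProjRep where
  alg : Type
  [cstar : NonUnitalCStarAlgebra alg]
  e : alg
  p : alg
  q : alg
  e_proj : IsStarProjection e
  p_proj : IsStarProjection p
  q_proj : IsStarProjection q
  e_mul_p : e * p = p
  p_mul_e : p * e = p
  e_mul_q : e * q = q
  q_mul_e : q * e = q

attribute [instance] TwoProjRep.cstar

/-- Bounded families indexed by all representations of the generators and relations. -/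
abbrev TwoProjFamily : Type 1 := lp (fun r : TwoProjRep => r.alg) ∞

/-- A family of projections, as a bounded family. -/
def projFamily (x : ∀ r : TwoProjRep, r.alg) (hx : ∀ r, IsStarProjection (x r)) : TwoProjFamily :=
  ⟨x, memℓp_infty ⟨1, by
    rintro _ ⟨r, rfl⟩
    exact (hx r).norm_le⟩⟩

/-- The generators `1`, `p`, `q` in the product of all representations. -/
def twoProjFamilyGen : Fin 3 → TwoProjFamily :=
  ![projFamily TwoProjRep.e TwoProjRep.e_proj, projFamily TwoProjRep.p TwoProjRep.p_proj,
    projFamily TwoProjRep.q TwoProjRep.q_proj]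

/-- The universal C⋆-algebra `C⋆(p, q, 1 | p, q, 1 projections, 1p = p1 = p, 1q = q1 = q)`: the
norm of a `*`-polynomial in the generators is the supremum of its norms over all representations of
the generators and relations. -/
def TwoProj : Type 1 := CStarGen (Set.range twoProjFamilyGen)

instance : NonUnitalCStarAlgebra TwoProj :=
  inferInstanceAs (NonUnitalCStarAlgebra (CStarGen (Set.range twoProjFamilyGen)))

/-- The unit of the universal C⋆-algebra generated by two projections. -/
def TwoProj.unit : TwoProj := CStarGen.of (twoProjFamilyGen 0) ⟨0, rfl⟩

/-- The first generating projection. -/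
def TwoProj.p : TwoProj := CStarGen.of (twoProjFamilyGen 1) ⟨1, rfl⟩

/-- The second generating projection. -/
def TwoProj.q : TwoProj := CStarGen.of (twoProjFamilyGen 2) ⟨2, rfl⟩

/-! ## The sequence of models -/

/-- The matrix `R_{(a,b),(c,d)}` over the universal C⋆-algebra generated by two projections. -/
def matR {N : ℕ} (a b c d : Fin N) : MatPair.{1} N where
  carrier := TwoProj
  mat := fun i j =>
    if i = j then
      if i = a ∨ i = b then TwoProj.p else if i = c ∨ i = d then TwoProj.q else TwoProj.unit
    else if (i = a ∧ j = b) ∨ (i = b ∧ j = a) then TwoProj.unit - TwoProj.p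
    else if (i = c ∧ j = d) ∨ (i = d ∧ j = c) then TwoProj.unit - TwoProj.q
    else 0

/-- The object `(B₁, M₁)`: `M₁` is the `L`-th power of the product of the matrices `R_{(a,b),*}`,
where `(a, b)` runs through the nonempty list `p₀ :: ps` and `R_{(a,b),*}` stands for
`R_{(a,b),(c(a,b),d(a,b))}`, and `B₁` is generated by the entries of `M₁`. -/
def modelOne {N : ℕ} (L : ℕ+) (c d : Fin N → Fin N → Fin N) (p₀ : Fin N × Fin N)
    (ps : List (Fin N × Fin N)) : CatObj.{1} N :=
  (((matR p₀.1 p₀.2 (c p₀.1 p₀.2) (d p₀.1 p₀.2)).wprodList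
    (ps.map fun p => matR p.1 p.2 (c p.1 p.2) (d p.1 p.2))).wpow L).generatedObj

/-- For an object `(B₁, M₁)`, the object `(Bₙ, Mₙ)`: `Mₙ` is the `n`-th power of `M₁` and
`Bₙ ⊆ B₁ ⊗ ⋯ ⊗ B₁` is generated by the entries of `Mₙ`. -/
def CatObj.model {N : ℕ} (X : CatObj.{u} N) (n : ℕ+) : CatObj.{u} N :=
  (X.toMatPair.wpow n).generatedObj

end

noncomputable section

universe u v w

/-! ## Families of `*`-homomorphisms -/

section Families

variable {A : Type u} [NonUnitalCStarAlgebra A] {ι : Type v} {Z : ι → Type w}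
  [∀ i, NonUnitalCStarAlgebra (Z i)]

/-! Two properties of the matrices R carry the theorem: they are magic unitaries
(`MatPair.IsMagic`), and they have a counit, the `*`-homomorphism to ℂ with p, q ↦ 1, which sends
the matrix to the identity matrix. Both pass to Woronowicz products, hence to every M_n. Slicing the
last factor of M_{n+1} = M_n ⦶ M_1 with the counit of M_1 returns M_n (`maps_wprod_left`); this
gives the arrows. Entries are projections, so their sequences are bounded, and the C⋆-algebra these
generate in the product of the B_n is the limit. The arrows of any limit are jointly injective, so
the magic relations hold there too and yield the unit and the unitarity.

For Δ, associativity carries M_{n+m} to M_n ⦶ M_m. The maps from B_∞ ⊗ B_∞ to tensor products of two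
levels are jointly injective, so these homomorphisms lift to one Δ (`exists_comultiplication`).
Since (id ⊗ ε)Δ = id for the counit ε, Δ is injective, hence isometric.

The analytic part shows that the minimal tensor product, defined by GNS representations, has slice
maps for all bounded functionals, and that products of separating families of functionals separate
its points. Homomorphisms on tensor products, and Δ, then come from `exists_hom_of_compatible`: the
`*`-algebra generated by the desired pairs (x, φ x) has a closure which functionals show to be a
graph. -/

theorem nonUnitalStarAlgHom_continuous {B : Type v} [NonUnitalCStarAlgebra B]
    (φ : A →⋆ₙₐ[ℂ] B) : Continuous φ :=
  AddMonoidHomClass.continuous_of_bound φ 1 fun a => by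
    simpa using NonUnitalStarAlgHom.norm_apply_le φ a

/-- A `*`-homomorphism as a continuous linear map. -/
def NonUnitalStarAlgHom.toCLM {B : Type v} [NonUnitalCStarAlgebra B]
    (φ : A →⋆ₙₐ[ℂ] B) : A →L[ℂ] B where
  toFun := φ
  map_add' := map_add φ
  map_smul' := map_smul φ
  cont := nonUnitalStarAlgHom_continuous φ

@[simp]
theorem NonUnitalStarAlgHom.toCLM_apply {B : Type v} [NonUnitalCStarAlgebra B]
    (φ : A →⋆ₙₐ[ℂ] B) (a : A) : φ.toCLM a = φ a := rfl

/-- The `*`-homomorphism into the product of C⋆-algebras given by a family of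
`*`-homomorphisms. -/
def lpLift (φ : ∀ i, A →⋆ₙₐ[ℂ] Z i) : A →⋆ₙₐ[ℂ] lp Z ∞ where
  toFun a := ⟨fun i => φ i a, memℓp_infty ⟨‖a‖, by
    rintro _ ⟨i, rfl⟩
    exact NonUnitalStarAlgHom.norm_apply_le (φ i) a⟩⟩
  map_smul' r a := by ext i; exact map_smul (φ i) r a
  map_zero' := by ext i; exact map_zero (φ i)
  map_add' a b := by ext i; exact map_add (φ i) a b
  map_mul' a b := by ext i; exact map_mul (φ i) a b
  map_star' a := by ext i; exact map_star (φ i) a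

@[simp]
theorem lpLift_apply (φ : ∀ i, A →⋆ₙₐ[ℂ] Z i) (a : A) (i : ι) : lpLift φ a i = φ i a := rfl

/-- The coordinate projections of a product of C⋆-algebras. -/
def lpEval (Z : ι → Type w) [∀ i, NonUnitalCStarAlgebra (Z i)] (i : ι) : lp Z ∞ →⋆ₙₐ[ℂ] Z i where
  toFun a := a i
  map_smul' _ _ := rfl
  map_zero' := rfl
  map_add' _ _ := rfl
  map_mul' _ _ := rfl
  map_star' _ := rfl

@[simp]
theorem lpEval_apply (i : ι) (a : lp Z ∞) : lpEval Z i a = a i := rfl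

/-- The combined map into the product is injective, and injective `*`-homomorphisms are isometric.
-/
theorem norm_le_of_jointly_injective (φ : ∀ i, A →⋆ₙₐ[ℂ] Z i)
    (hφ : ∀ a, (∀ i, φ i a = 0) → a = 0) {a : A} {M : ℝ} (hM : 0 ≤ M)
    (h : ∀ i, ‖φ i a‖ ≤ M) : ‖a‖ ≤ M := by
  have hinj : Function.Injective (lpLift φ) := by
    rw [injective_iff_map_eq_zero]
    intro x hx
    exact hφ x fun i => by rw [← lpLift_apply, hx]; rfl
  rw [← NonUnitalStarAlgHom.norm_map (lpLift φ) hinj a]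
  exact lp.norm_le_of_forall_le hM h

/-- Two `*`-homomorphisms agreeing on a generating set are equal. -/
theorem cstarGen_hom_ext {B : Type v} [NonUnitalCStarAlgebra B] {s : Set A} {φ ψ : A →⋆ₙₐ[ℂ] B}
    (h : Set.EqOn φ ψ s) {x : A} (hx : x ∈ cstarGen s) : φ x = ψ x := by
  have hle : NonUnitalStarAlgebra.adjoin ℂ s ≤ NonUnitalStarAlgHom.equalizer φ ψ :=
    NonUnitalStarAlgebra.adjoin_le h
  have : Set.EqOn φ ψ (NonUnitalStarAlgebra.adjoin ℂ s) := fun y hy => hle hy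
  exact this.closure (nonUnitalStarAlgHom_continuous φ) (nonUnitalStarAlgHom_continuous ψ) hx

/-- A closed `*`-subalgebra contains the C⋆-algebra generated by any of its subsets. -/
theorem cstarGen_le {s : Set A} {S : NonUnitalStarSubalgebra ℂ A} (hS : IsClosed (S : Set A))
    (h : s ⊆ S) : cstarGen s ≤ S :=
  NonUnitalStarSubalgebra.topologicalClosure_minimal _ (NonUnitalStarAlgebra.adjoin_le h) hS

/-- An element of the image of a generated algebra lies in the algebra generated by the image. -/
theorem map_mem_cstarGen {B : Type v} [NonUnitalCStarAlgebra B] {s : Set A} {t : Set B}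
    (φ : A →⋆ₙₐ[ℂ] B) (h : ∀ x ∈ s, φ x ∈ cstarGen t) {x : A} (hx : x ∈ cstarGen s) :
    φ x ∈ cstarGen t := by
  have hle : cstarGen s ≤ (cstarGen t).comap φ :=
    cstarGen_le ((cstarGen_isClosed t).preimage (nonUnitalStarAlgHom_continuous φ)) h
  exact hle hx

/-- Functionals that are compatible on a `*`-subalgebra of a product and separate the points of
the second factor give rise to a `*`-homomorphism. -/
theorem exists_hom_of_compatible {E : Type u} {E' : Type v} [NonUnitalCStarAlgebra E]
    [NonUnitalCStarAlgebra E'] (G : NonUnitalStarSubalgebra ℂ (E × E')) {s : Set E}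
    (hs : cstarGen s = ⊤) (hG : ∀ x ∈ s, ∃ y, (x, y) ∈ G) {ι : Type w}
    (h : ι → E →L[ℂ] ℂ) (h' : ι → E' →L[ℂ] ℂ)
    (hcomp : ∀ i, ∀ z ∈ G, h i z.1 = h' i z.2) (hsep : ∀ y, (∀ i, h' i y = 0) → y = 0) :
    ∃ φ : E →⋆ₙₐ[ℂ] E', ∀ z ∈ G, φ z.1 = z.2 := by
  let K : NonUnitalStarSubalgebra ℂ (E × E') := G.topologicalClosure
  have hKc : IsClosed (K : Set (E × E')) := NonUnitalStarSubalgebra.isClosed_topologicalClosure _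
  let _ : NonUnitalCStarAlgebra K := NonUnitalStarSubalgebra.nonUnitalCStarAlgebra K
  let p₁ : K →⋆ₙₐ[ℂ] E :=
    (NonUnitalStarAlgHom.fst ℂ E E').comp (NonUnitalStarSubalgebraClass.subtype K)
  let p₂ : K →⋆ₙₐ[ℂ] E' :=
    (NonUnitalStarAlgHom.snd ℂ E E').comp (NonUnitalStarSubalgebraClass.subtype K)
  have hcompK : ∀ i, ∀ z ∈ K, h i z.1 = h' i z.2 := fun i => by
    have : Set.EqOn (fun z : E × E' => h i z.1) (fun z => h' i z.2) G := hcomp i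
    exact this.closure (by fun_prop) (by fun_prop)
  -- If (0, y) lies in `K`, every `h' i` kills y, so y = 0: `K` is a graph over its first
  -- coordinate.
  have hinj : Function.Injective p₁ := by
    rw [injective_iff_map_eq_zero]
    rintro ⟨⟨x, y⟩, hz⟩ (hx : x = 0)
    subst hx
    have : y = 0 := hsep y fun i => by rw [← hcompK i _ hz]; exact map_zero _
    subst this
    rfl
  -- An isometric image is closed, and this one contains the generators.
  have hsurj : Function.Surjective p₁ := by
    have hcl : IsClosed (NonUnitalStarAlgHom.range p₁ : Set E) := by
      rw [NonUnitalStarAlgHom.coe_range]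
      exact (NonUnitalStarAlgHom.isometry p₁ hinj).isClosedEmbedding.isClosed_range
    have hle : cstarGen s ≤ NonUnitalStarAlgHom.range p₁ := by
      refine cstarGen_le hcl fun x hx => ?_
      obtain ⟨y, hy⟩ := hG x hx
      exact ⟨⟨(x, y), NonUnitalStarSubalgebra.le_topologicalClosure _ hy⟩, rfl⟩
    intro x
    have hx : x ∈ cstarGen s := by rw [hs]; trivial
    exact hle hx
  let e : K ≃⋆ₐ[ℂ] E := StarAlgEquiv.ofBijective p₁ ⟨hinj, hsurj⟩
  refine ⟨p₂.comp (e.symm : E →⋆ₙₐ[ℂ] K), fun z hz => ?_⟩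
  let z' : K := ⟨z, NonUnitalStarSubalgebra.le_topologicalClosure _ hz⟩
  have : e.symm z.1 = z' := by
    rw [StarAlgEquiv.symm_apply_eq]; rfl
  change p₂ (e.symm z.1) = z.2
  rw [this]
  rfl

end Families

/-! ## Positive functionals separate points -/

section GNS

attribute [local instance] CStarAlgebra.spectralOrder CStarAlgebra.spectralOrderedRing

open scoped ComplexOrder

variable {A : Type u} [NonUnitalCStarAlgebra A]

/-- Hahn–Banach separates -b from the closed positive cone by a real functional. Symmetrizing it
under the involution makes its complex-linear extension real on self-adjoint elements. -/
theorem exists_posFunctional_apply_ne_zero {b : A} (hb : 0 ≤ b) (hb0 : b ≠ 0) :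
    ∃ f : PosFunctional A, f b ≠ 0 := by
  have hnot : -b ∉ ProperCone.positive ℝ A := fun h =>
    hb0 (le_antisymm (neg_nonneg.mp h) hb)
  obtain ⟨f, hf, hfb⟩ := ProperCone.hyperplane_separation_point _ hnot
  have hfb' : 0 < f b := by simpa using hfb
  let g : Module.Dual ℝ A := f.toLinearMap + f.toLinearMap ∘ₗ (starLinearEquiv ℝ (A := A)).toLinearMap
  have hg : ∀ x, g x = f x + f (star x) := fun x => rfl
  let F : A →ₗ[ℂ] ℂ := g.extendRCLike
  have hF : ∀ x, IsSelfAdjoint x → F x = ((2 * f x : ℝ) : ℂ) := by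
    intro x hx
    change ((g x : ℝ) : ℂ) - Complex.I * ((g (Complex.I • x) : ℝ) : ℂ) = _
    -- For self-adjoint x, the star of i x is -i x, so `g` vanishes at i x and the imaginary part
    -- drops out.
    rw [hg, hg, star_smul, hx.star_eq]
    simp [two_mul]
  refine ⟨PositiveLinearMap.mk₀ F fun x hx => ?_, ?_⟩
  · rw [hF x (IsSelfAdjoint.of_nonneg hx)]
    have := hf x hx
    exact_mod_cast (by positivity : 0 ≤ 2 * f x)
  · change F b ≠ 0
    rw [hF b (IsSelfAdjoint.of_nonneg hb)]
    exact_mod_cast (by positivity : 2 * f b ≠ 0)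

/-- Without a unit there is no obvious cyclic vector, so a acts on the class of a⋆ instead; the
squared norm of the result is f((a a⋆)⋆(a a⋆)). -/
theorem eq_zero_of_gnsRep_eq_zero {a : A} (h : ∀ f : PosFunctional A, gnsRep f a = 0) :
    a = 0 := by
  by_contra ha
  have h1 : a * star a ≠ 0 := by simpa [CStarRing.mul_star_self_eq_zero_iff] using ha
  have h2 : star (a * star a) * (a * star a) ≠ 0 := by
    simpa only [ne_eq, CStarRing.star_mul_self_eq_zero_iff] using h1
  obtain ⟨f, hf⟩ := exists_posFunctional_apply_ne_zero (star_mul_self_nonneg (a * star a)) h2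
  apply hf
  have h3 : gnsRep f a (f.toPreGNS (star a) : f.PreGNS) = 0 := by rw [h f]; rfl
  rw [PositiveLinearMap.gnsNonUnitalStarAlgHom_apply_coe] at h3
  have h4 : ‖f.leftMulMapPreGNS a (f.toPreGNS (star a))‖ = 0 := by
    rw [← UniformSpace.Completion.norm_coe, h3, norm_zero]
  have h5 := f.preGNS_norm_sq (f.leftMulMapPreGNS a (f.toPreGNS (star a)))
  rw [h4] at h5
  simpa using h5.symm

theorem norm_le_of_norm_gnsRep_le {a : A} {M : ℝ} (hM : 0 ≤ M)
    (h : ∀ f : PosFunctional A, ‖gnsRep f a‖ ≤ M) : ‖a‖ ≤ M :=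
  norm_le_of_jointly_injective (fun f : PosFunctional A => gnsRep f)
    (fun _ => eq_zero_of_gnsRep_eq_zero) hM h

/-- A bound for the matrix coefficients of the GNS representations bounds the norm. -/
theorem norm_le_of_gnsRep_inner_le {a : A} {M : ℝ} (hM : 0 ≤ M)
    (h : ∀ (f : PosFunctional A) (x y : GNSSpace f),
      ‖inner ℂ x (gnsRep f a y)‖ ≤ M * ‖x‖ * ‖y‖) : ‖a‖ ≤ M := by
  refine norm_le_of_norm_gnsRep_le hM fun f => ContinuousLinearMap.opNorm_le_bound _ hM fun y => ?_
  rcases (norm_nonneg (gnsRep f a y)).eq_or_lt with h0 | h0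
  · rw [← h0]; positivity
  -- Testing against π_f(a)y itself bounds its squared norm; one factor then cancels.
  · have := h f (gnsRep f a y) y
    rw [inner_self_eq_norm_sq_to_K] at this
    simp only [norm_pow, RCLike.norm_ofReal, abs_norm] at this
    nlinarith

end GNS

/-! ## Elementary tensors and matrix coefficients -/

/-- The span of a `*`-semigroup is already a `*`-algebra. Statements about generated algebras thus
reduce to linear ones, which functionals can handle. -/
theorem mem_span_of_mem_adjoin {E : Type u} [NonUnitalCStarAlgebra E] {S : Set E}
    (hmul : ∀ x ∈ S, ∀ y ∈ S, x * y ∈ S) (hstar : ∀ x ∈ S, star x ∈ S) {x : E}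
    (hx : x ∈ NonUnitalStarAlgebra.adjoin ℂ S) : x ∈ Submodule.span ℂ S := by
  have h1 : S ∪ star S = S := Set.union_eq_self_of_subset_right fun y hy => by
    simpa using hstar _ (Set.mem_star.mp hy)
  have h2 : (Subsemigroup.closure S : Set E) = S :=
    congrArg SetLike.coe (Subsemigroup.closure_eq (⟨S, fun ha hb => hmul _ ha _ hb⟩ : Subsemigroup E))
  have h3 := NonUnitalStarAlgebra.adjoin_eq_span (R := ℂ) S
  rw [h1, h2] at h3
  rw [← h3]
  exact hx

section MinTensor

variable {A : Type u} [NonUnitalCStarAlgebra A] {B : Type v} [NonUnitalCStarAlgebra B]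

/-- The product vector `x ⊗ y` in the tensor product of two GNS spaces. -/
def gnsTmul {i : PosFunctional A × PosFunctional B} (x : GNSSpace i.1) (y : GNSSpace i.2) :
    GNSTensor i :=
  ((x ⊗ₜ[ℂ] y : GNSSpace i.1 ⊗[ℂ] GNSSpace i.2) :
    UniformSpace.Completion (GNSSpace i.1 ⊗[ℂ] GNSSpace i.2))

theorem norm_gnsTmul {i : PosFunctional A × PosFunctional B} (x : GNSSpace i.1)
    (y : GNSSpace i.2) : ‖gnsTmul x y‖ = ‖x‖ * ‖y‖ :=
  (UniformSpace.Completion.norm_coe _).trans (TensorProduct.norm_tmul x y)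

theorem inner_gnsTmul {i : PosFunctional A × PosFunctional B} (x x' : GNSSpace i.1)
    (y y' : GNSSpace i.2) :
    inner ℂ (gnsTmul x y) (gnsTmul x' y') = inner ℂ x x' * inner ℂ y y' :=
  (UniformSpace.Completion.inner_coe _ _).trans (TensorProduct.inner_tmul ..)

theorem gnsTensorOp_gnsTmul (a : A) (b : B) {i : PosFunctional A × PosFunctional B}
    (x : GNSSpace i.1) (y : GNSSpace i.2) :
    gnsTensorOp a b i (gnsTmul x y) = gnsTmul (gnsRep i.1 a x) (gnsRep i.2 b y) :=
  ContinuousLinearMap.completion_apply_coe _ _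

/-- The product vectors span a dense subspace. -/
theorem gnsTensor_induction {i : PosFunctional A × PosFunctional B} {p : GNSTensor i → Prop}
    (hc : IsClosed {x | p x}) (h0 : p 0) (ha : ∀ x y, p x → p y → p (x + y))
    (ht : ∀ x y, p (gnsTmul x y)) (x : GNSTensor i) : p x := by
  induction x using UniformSpace.Completion.induction_on with
  | hp => exact hc
  | ih x =>
    induction x with
    | zero => exact h0
    | tmul x y => exact ht x y
    | add x y hx hy =>
      rw [UniformSpace.Completion.coe_add]
      exact ha _ _ hx hy

theorem gnsTensor_op_ext {i : PosFunctional A × PosFunctional B}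
    {S T : GNSTensor i →L[ℂ] GNSTensor i}
    (h : ∀ x y, S (gnsTmul x y) = T (gnsTmul x y)) : S = T := by
  ext z
  induction z using gnsTensor_induction with
  | hc => exact isClosed_eq S.continuous T.continuous
  | h0 => rw [map_zero, map_zero]
  | ha x y hx hy => rw [map_add, map_add, hx, hy]
  | ht x y => exact h x y

theorem gnsTensor_eq_zero_of_inner {i : PosFunctional A × PosFunctional B} {z : GNSTensor i}
    (h : ∀ x y, inner ℂ (gnsTmul x y) z = 0) : z = 0 := by
  have : ∀ w : GNSTensor i, inner ℂ w z = 0 := by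
    intro w
    induction w using gnsTensor_induction with
    | hc => exact isClosed_eq (by fun_prop) (by fun_prop)
    | h0 => exact inner_zero_left _
    | ha x y hx hy => rw [inner_add_left, hx, hy, add_zero]
    | ht x y => exact h x y
  exact inner_self_eq_zero.mp (this z)

theorem gnsTmul_add_left {i : PosFunctional A × PosFunctional B} (x x' : GNSSpace i.1)
    (y : GNSSpace i.2) : gnsTmul (x + x') y = gnsTmul x y + gnsTmul (i := i) x' y := by
  simp only [gnsTmul, TensorProduct.add_tmul]
  exact UniformSpace.Completion.coe_add _ _

theorem gnsTmul_add_right {i : PosFunctional A × PosFunctional B} (x : GNSSpace i.1)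
    (y y' : GNSSpace i.2) : gnsTmul x (y + y') = gnsTmul x y + gnsTmul (i := i) x y' := by
  simp only [gnsTmul, TensorProduct.tmul_add]
  exact UniformSpace.Completion.coe_add _ _

theorem gnsTmul_smul_left {i : PosFunctional A × PosFunctional B} (r : ℂ) (x : GNSSpace i.1)
    (y : GNSSpace i.2) : gnsTmul (r • x) y = r • gnsTmul (i := i) x y := by
  simp only [gnsTmul, ← TensorProduct.smul_tmul']
  exact UniformSpace.Completion.coe_smul _ _

theorem gnsTmul_smul_right {i : PosFunctional A × PosFunctional B} (r : ℂ) (x : GNSSpace i.1)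
    (y : GNSSpace i.2) : gnsTmul x (r • y) = r • gnsTmul (i := i) x y := by
  simp only [gnsTmul, TensorProduct.tmul_smul]
  exact UniformSpace.Completion.coe_smul _ _

/-- The coordinate representations of the minimal tensor product. -/
def minRep (i : PosFunctional A × PosFunctional B) :
    MinTensor A B →⋆ₙₐ[ℂ] (GNSTensor i →L[ℂ] GNSTensor i) :=
  (lpEval (fun i : PosFunctional A × PosFunctional B => GNSTensor i →L[ℂ] GNSTensor i) i).comp
    (CStarGen.incl (Set.range fun x : A × B => elemTensor x.1 x.2))

@[simp]
theorem minRep_minTmul (i : PosFunctional A × PosFunctional B) (a : A) (b : B) :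
    minRep i (minTmul a b) = gnsTensorOp a b i := rfl

theorem minTensor_ext {x y : MinTensor A B}
    (h : ∀ i : PosFunctional A × PosFunctional B, minRep i x = minRep i y) : x = y :=
  Subtype.ext (lp.ext (funext h))

theorem minTmul_add_left (a a' : A) (b : B) :
    minTmul (a + a') b = minTmul a b + minTmul a' b :=
  minTensor_ext fun i => gnsTensor_op_ext fun x y => by
    simp [gnsTensorOp_gnsTmul, gnsTmul_add_left]

theorem minTmul_add_right (a : A) (b b' : B) :
    minTmul a (b + b') = minTmul a b + minTmul a b' :=
  minTensor_ext fun i => gnsTensor_op_ext fun x y => by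
    simp [gnsTensorOp_gnsTmul, gnsTmul_add_right]

theorem minTmul_smul_left (r : ℂ) (a : A) (b : B) :
    minTmul (r • a) b = r • minTmul a b :=
  minTensor_ext fun i => gnsTensor_op_ext fun x y => by
    simp [gnsTensorOp_gnsTmul, gnsTmul_smul_left]

theorem minTmul_smul_right (r : ℂ) (a : A) (b : B) :
    minTmul a (r • b) = r • minTmul a b :=
  minTensor_ext fun i => gnsTensor_op_ext fun x y => by
    simp [gnsTensorOp_gnsTmul, gnsTmul_smul_right]

theorem minTmul_mul (a a' : A) (b b' : B) :
    minTmul a b * minTmul a' b' = minTmul (a * a') (b * b') :=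
  minTensor_ext fun i => gnsTensor_op_ext fun x y => by
    simp [gnsTensorOp_gnsTmul]

theorem star_minTmul (a : A) (b : B) :
    star (minTmul a b) = minTmul (star a) (star b) := by
  refine minTensor_ext fun i => ?_
  rw [map_star, minRep_minTmul, minRep_minTmul, ContinuousLinearMap.star_eq_adjoint]
  refine gnsTensor_op_ext fun x y => ?_
  rw [← sub_eq_zero]
  -- On product vectors the inner product factors, so the adjoint may be taken in each leg.
  refine gnsTensor_eq_zero_of_inner fun x' y' => ?_
  rw [inner_sub_right, ContinuousLinearMap.adjoint_inner_right, gnsTensorOp_gnsTmul,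
    gnsTensorOp_gnsTmul, inner_gnsTmul, inner_gnsTmul, map_star, map_star,
    ContinuousLinearMap.star_eq_adjoint, ContinuousLinearMap.star_eq_adjoint,
    ContinuousLinearMap.adjoint_inner_right, ContinuousLinearMap.adjoint_inner_right, sub_self]

/-- The canonical map from the algebraic to the minimal tensor product. -/
def minMk (A : Type u) [NonUnitalCStarAlgebra A] (B : Type v) [NonUnitalCStarAlgebra B] :
    A ⊗[ℂ] B →ₗ[ℂ] MinTensor A B :=
  TensorProduct.lift (LinearMap.mk₂ ℂ minTmul minTmul_add_left minTmul_smul_left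
    minTmul_add_right minTmul_smul_right)

@[simp]
theorem minMk_tmul (a : A) (b : B) : minMk A B (a ⊗ₜ b) = minTmul a b := rfl

theorem cstarGen_minTmul :
    cstarGen (Set.range fun x : A × B => minTmul x.1 x.2) = ⊤ :=
  cstarGen_eq_top _ _ (by rintro _ ⟨x, rfl⟩; exact ⟨x, rfl⟩)

theorem denseRange_minMk : DenseRange (minMk A B) := by
  intro x
  have hx : x ∈ cstarGen (Set.range fun x : A × B => minTmul x.1 x.2) := by
    rw [cstarGen_minTmul]; trivial
  refine closure_mono (fun y hy => ?_) hx
  have hy' := mem_span_of_mem_adjoin (by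
    rintro _ ⟨x, rfl⟩ _ ⟨y, rfl⟩
    exact ⟨x * y, (minTmul_mul _ _ _ _).symm⟩) (by
    rintro _ ⟨x, rfl⟩
    exact ⟨star x, (star_minTmul _ _).symm⟩) hy
  have hle : Submodule.span ℂ (Set.range fun x : A × B => minTmul x.1 x.2) ≤
      LinearMap.range (minMk A B) := by
    rw [Submodule.span_le]
    rintro _ ⟨x, rfl⟩
    exact ⟨x.1 ⊗ₜ x.2, rfl⟩
  exact hle hy'

theorem minTensor_clm_ext {E : Type w} [NormedAddCommGroup E] [NormedSpace ℂ E]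
    {S T : MinTensor A B →L[ℂ] E} (h : ∀ a b, S (minTmul a b) = T (minTmul a b)) : S = T := by
  have h1 : S.toLinearMap ∘ₗ minMk A B = T.toLinearMap ∘ₗ minMk A B :=
    TensorProduct.ext' fun a b => h a b
  have h2 := denseRange_minMk.equalizer S.continuous T.continuous
    (funext fun x => LinearMap.congr_fun h1 x)
  exact DFunLike.coe_injective h2

/-! ## Slice maps -/

/-- A matrix coefficient of a GNS representation. -/
def gnsCoeff (f : PosFunctional A) (x y : GNSSpace f) : A →L[ℂ] ℂ :=
  (innerSL ℂ x) ∘L (ContinuousLinearMap.apply ℂ (GNSSpace f) y) ∘L (gnsRep f).toCLM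

@[simp]
theorem gnsCoeff_apply (f : PosFunctional A) (x y : GNSSpace f) (a : A) :
    gnsCoeff f x y a = inner ℂ x (gnsRep f a y) := rfl

/-- The algebraic slice map `a ⊗ b ↦ f a • b`. -/
def algSliceLeft (f : A →L[ℂ] ℂ) : A ⊗[ℂ] B →ₗ[ℂ] B :=
  (TensorProduct.lid ℂ B).toLinearMap ∘ₗ LinearMap.rTensor B f.toLinearMap

/-- The algebraic slice map `a ⊗ b ↦ g b • a`. -/
def algSliceRight (g : B →L[ℂ] ℂ) : A ⊗[ℂ] B →ₗ[ℂ] A :=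
  (TensorProduct.rid ℂ A).toLinearMap ∘ₗ LinearMap.lTensor A g.toLinearMap

@[simp]
theorem algSliceLeft_tmul (f : A →L[ℂ] ℂ) (a : A) (b : B) :
    algSliceLeft f (a ⊗ₜ b) = f a • b := rfl

@[simp]
theorem algSliceRight_tmul (g : B →L[ℂ] ℂ) (a : A) (b : B) :
    algSliceRight g (a ⊗ₜ b) = g b • a := rfl

/-- Both sides are f ⊗ g; the exchange of legs lets bounds for one kind of slice pass to the other.
-/
theorem apply_algSlice (f : A →L[ℂ] ℂ) (g : B →L[ℂ] ℂ) (s : A ⊗[ℂ] B) :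
    g (algSliceLeft f s) = f (algSliceRight g s) := by
  induction s with
  | zero => simp
  | tmul a b => simp [mul_comm]
  | add s t hs ht => rw [map_add, map_add, map_add, map_add, hs, ht]

theorem gnsCoeff_algSliceLeft (i : PosFunctional A × PosFunctional B) (x y : GNSSpace i.1)
    (x' y' : GNSSpace i.2) (s : A ⊗[ℂ] B) :
    gnsCoeff i.2 x' y' (algSliceLeft (gnsCoeff i.1 x y) s) =
      inner ℂ (gnsTmul x x') (minRep i (minMk A B s) (gnsTmul y y')) := by
  induction s with
  | zero => simp
  | tmul a b =>
    rw [algSliceLeft_tmul, minMk_tmul, minRep_minTmul, gnsTensorOp_gnsTmul, inner_gnsTmul,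
      map_smul, smul_eq_mul, gnsCoeff_apply, gnsCoeff_apply]
  | add s t hs ht =>
    rw [map_add, map_add, map_add, map_add, hs, ht, add_apply, inner_add_right]

/-- First of three bounds. For a GNS coefficient, each coefficient of the slice is a coefficient of
π_f ⊗ π_g between product vectors, which the minimal norm controls by definition. -/
theorem norm_algSliceLeft_gnsCoeff_le (f : PosFunctional A) (x y : GNSSpace f) (s : A ⊗[ℂ] B) :
    ‖algSliceLeft (gnsCoeff f x y) s‖ ≤ ‖x‖ * ‖y‖ * ‖minMk A B s‖ := by
  refine norm_le_of_gnsRep_inner_le (by positivity) fun g x' y' => ?_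
  have h := gnsCoeff_algSliceLeft (f, g) x y x' y' s
  rw [gnsCoeff_apply] at h
  rw [h]
  refine (norm_inner_le_norm _ _).trans ?_
  have h1 : ‖minRep (f, g) (minMk A B s) (gnsTmul y y')‖ ≤ ‖minMk A B s‖ * (‖y‖ * ‖y'‖) := by
    refine (ContinuousLinearMap.le_opNorm _ _).trans ?_
    rw [norm_gnsTmul]
    gcongr
    exact NonUnitalStarAlgHom.norm_apply_le _ _
  rw [norm_gnsTmul]
  calc ‖x‖ * ‖x'‖ * _ ≤ ‖x‖ * ‖x'‖ * (‖minMk A B s‖ * (‖y‖ * ‖y'‖)) := by gcongr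
    _ = _ := by ring

/-- GNS coefficients on A suffice to compute norms in A, so exchanging the legs extends the previous
bound to arbitrary g. -/
theorem norm_algSliceRight_le (g : B →L[ℂ] ℂ) (s : A ⊗[ℂ] B) :
    ‖algSliceRight g s‖ ≤ ‖g‖ * ‖minMk A B s‖ := by
  refine norm_le_of_gnsRep_inner_le (by positivity) fun f x y => ?_
  rw [← gnsCoeff_apply, ← apply_algSlice]
  calc _ ≤ ‖g‖ * (‖x‖ * ‖y‖ * ‖minMk A B s‖) :=
        g.le_opNorm_of_le (norm_algSliceLeft_gnsCoeff_le f x y s)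
    _ = _ := by ring

/-- A second exchange, now with Hahn–Banach computing the norm in B, removes the restriction on f.
-/
theorem norm_algSliceLeft_le (f : A →L[ℂ] ℂ) (s : A ⊗[ℂ] B) :
    ‖algSliceLeft f s‖ ≤ ‖f‖ * ‖minMk A B s‖ := by
  refine NormedSpace.norm_le_dual_bound ℂ _ (by positivity) fun g => ?_
  rw [apply_algSlice]
  calc _ ≤ ‖f‖ * (‖g‖ * ‖minMk A B s‖) := f.le_opNorm_of_le (norm_algSliceRight_le g s)
    _ = _ := by ring

/-- The slice map `f ⊗ id`. -/
def sliceLeft (f : A →L[ℂ] ℂ) : MinTensor A B →L[ℂ] B :=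
  (algSliceLeft f).extendOfNorm (minMk A B)

/-- The slice map `id ⊗ g`. -/
def sliceRight (g : B →L[ℂ] ℂ) : MinTensor A B →L[ℂ] A :=
  (algSliceRight g).extendOfNorm (minMk A B)

@[simp]
theorem sliceLeft_minTmul (f : A →L[ℂ] ℂ) (a : A) (b : B) :
    sliceLeft f (minTmul a b) = f a • b :=
  LinearMap.extendOfNorm_eq denseRange_minMk ⟨‖f‖, norm_algSliceLeft_le f⟩ (a ⊗ₜ b)

@[simp]
theorem sliceRight_minTmul (g : B →L[ℂ] ℂ) (a : A) (b : B) :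
    sliceRight g (minTmul a b) = g b • a :=
  LinearMap.extendOfNorm_eq denseRange_minMk ⟨‖g‖, norm_algSliceRight_le g⟩ (a ⊗ₜ b)

/-- The product functional `f ⊗ g`. -/
def prodFun (f : A →L[ℂ] ℂ) (g : B →L[ℂ] ℂ) : MinTensor A B →L[ℂ] ℂ :=
  g ∘L sliceLeft f

@[simp]
theorem prodFun_minTmul (f : A →L[ℂ] ℂ) (g : B →L[ℂ] ℂ) (a : A) (b : B) :
    prodFun f g (minTmul a b) = f a * g b := by
  simp [prodFun]

theorem prodFun_eq_sliceRight (f : A →L[ℂ] ℂ) (g : B →L[ℂ] ℂ) :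
    prodFun f g = f ∘L sliceRight g :=
  minTensor_clm_ext fun a b => by simp [mul_comm]

theorem prodFun_gnsCoeff (i : PosFunctional A × PosFunctional B) (x y : GNSSpace i.1)
    (x' y' : GNSSpace i.2) (s : MinTensor A B) :
    prodFun (gnsCoeff i.1 x y) (gnsCoeff i.2 x' y') s =
      inner ℂ (gnsTmul x x') (minRep i s (gnsTmul y y')) := by
  have h : prodFun (gnsCoeff i.1 x y) (gnsCoeff i.2 x' y') =
      (innerSL ℂ (gnsTmul x x')) ∘L
        (ContinuousLinearMap.apply ℂ (GNSTensor i) (gnsTmul y y')) ∘L (minRep i).toCLM := by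
    refine minTensor_clm_ext fun a b => ?_
    rw [prodFun_minTmul]
    exact ((congrArg _ (gnsTensorOp_gnsTmul a b y y')).trans (inner_gnsTmul _ _ _ _)).symm
  exact DFunLike.congr_fun h s

/-- Product functionals include the coefficients of every π_f ⊗ π_g at product vectors, and product
vectors are total. -/
theorem eq_zero_of_prodFun_eq_zero {x : MinTensor A B} (h : ∀ f g, prodFun f g x = 0) :
    x = 0 := by
  refine minTensor_ext fun i => ?_
  rw [map_zero]
  refine gnsTensor_op_ext fun y y' => gnsTensor_eq_zero_of_inner fun z z' => ?_
  rw [← prodFun_gnsCoeff, h]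

/-- Products of separating families of functionals separate the points of the minimal tensor
product. -/
theorem eq_zero_of_prodFun_family_eq_zero {ι κ : Type*} {F : ι → A →L[ℂ] ℂ} {G : κ → B →L[ℂ] ℂ}
    (hF : ∀ a, (∀ i, F i a = 0) → a = 0) (hG : ∀ b, (∀ j, G j b = 0) → b = 0)
    {x : MinTensor A B} (h : ∀ i j, prodFun (F i) (G j) x = 0) : x = 0 := by
  refine eq_zero_of_prodFun_eq_zero fun f g => ?_
  -- The legs are treated one at a time: `G` kills the left slices by the `F i`, so each `F i` kills
  -- every right slice.
  have h1 : ∀ i, sliceLeft (F i) x = 0 := fun i => hG _ fun j => h i j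
  have h2 : sliceRight g x = 0 := hF _ fun i => by
    have : prodFun (F i) g x = 0 := by
      change g (sliceLeft (F i) x) = 0
      rw [h1, map_zero]
    rwa [prodFun_eq_sliceRight] at this
  rw [prodFun_eq_sliceRight]
  change f (sliceRight g x) = 0
  rw [h2, map_zero]

/-! ## Homomorphisms out of minimal tensor products -/

theorem eq_zero_of_forall_dual {E : Type u} [NonUnitalCStarAlgebra E] {x : E}
    (h : ∀ f : E →L[ℂ] ℂ, f x = 0) : x = 0 :=
  SeparatingDual.eq_zero_of_forall_dual_eq_zero (R := ℂ) h

/-- A `*`-semigroup of generators, together with compatible functionals, determines a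
`*`-homomorphism. -/
theorem exists_hom_of_generators {S : Type*} [Mul S] [Star S] {E : Type u} {E' : Type v}
    [NonUnitalCStarAlgebra E] [NonUnitalCStarAlgebra E'] (e : S → E) (e' : S → E')
    (he_mul : ∀ s t, e s * e t = e (s * t)) (he_star : ∀ s, star (e s) = e (star s))
    (he'_mul : ∀ s t, e' s * e' t = e' (s * t)) (he'_star : ∀ s, star (e' s) = e' (star s))
    (hgen : cstarGen (Set.range e) = ⊤) {ι : Type*}
    (h : ι → E →L[ℂ] ℂ) (h' : ι → E' →L[ℂ] ℂ) (hcomp : ∀ i s, h i (e s) = h' i (e' s))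
    (hsep : ∀ y, (∀ i, h' i y = 0) → y = 0) :
    ∃ φ : E →⋆ₙₐ[ℂ] E', ∀ s, φ (e s) = e' s := by
  let T : Set (E × E') := Set.range fun s => (e s, e' s)
  have hT : ∀ s, (e s, e' s) ∈ NonUnitalStarAlgebra.adjoin ℂ T := fun s =>
    NonUnitalStarAlgebra.subset_adjoin ℂ _ ⟨s, rfl⟩
  obtain ⟨φ, hφ⟩ := exists_hom_of_compatible (NonUnitalStarAlgebra.adjoin ℂ T) hgen
    (by rintro _ ⟨s, rfl⟩; exact ⟨e' s, hT s⟩) h h' (by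
      intro i z hz
      -- The functionals are linear but not multiplicative, so compatibility must be propagated
      -- along the span.
      have hz' := mem_span_of_mem_adjoin (by
        rintro _ ⟨s, rfl⟩ _ ⟨t, rfl⟩
        exact ⟨s * t, Prod.ext (he_mul s t).symm (he'_mul s t).symm⟩) (by
        rintro _ ⟨s, rfl⟩
        exact ⟨star s, Prod.ext (he_star s).symm (he'_star s).symm⟩) hz
      clear hz
      induction hz' using Submodule.span_induction with
      | mem x hx => obtain ⟨s, rfl⟩ := hx; exact hcomp i s
      | zero => simp
      | add x y _ _ hx hy => simp only [Prod.fst_add, Prod.snd_add, map_add, hx, hy]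
      | smul r x _ hx => simp only [Prod.smul_fst, Prod.smul_snd, map_smul, hx]) hsep
  exact ⟨φ, fun s => hφ _ (hT s)⟩

/-- The generators are indexed by the `*`-semigroup A × B; the separating functionals on E pull back
along t to product functionals, which are bounded for the minimal norm. -/
theorem exists_minTensor_hom {E : Type w} [NonUnitalCStarAlgebra E] (t : A × B → E)
    (ht_mul : ∀ x y, t x * t y = t (x * y)) (ht_star : ∀ x, star (t x) = t (star x))
    {ι : Type*} (f : ι → A →L[ℂ] ℂ) (g : ι → B →L[ℂ] ℂ) (h : ι → E →L[ℂ] ℂ)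
    (hcomp : ∀ i x, f i x.1 * g i x.2 = h i (t x)) (hsep : ∀ y, (∀ i, h i y = 0) → y = 0) :
    ∃ φ : MinTensor A B →⋆ₙₐ[ℂ] E, ∀ a b, φ (minTmul a b) = t (a, b) := by
  obtain ⟨φ, hφ⟩ := exists_hom_of_generators (fun x : A × B => minTmul x.1 x.2) t
    (fun _ _ => minTmul_mul _ _ _ _) (fun _ => star_minTmul _ _) ht_mul ht_star cstarGen_minTmul
    (fun i => prodFun (f i) (g i)) h (fun i x => by rw [prodFun_minTmul, hcomp]) hsep
  exact ⟨φ, fun a b => hφ (a, b)⟩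

/-- Functoriality of the minimal tensor product. -/
theorem exists_minTensor_map {A' : Type*} {B' : Type*} [NonUnitalCStarAlgebra A']
    [NonUnitalCStarAlgebra B'] (φ : A →⋆ₙₐ[ℂ] A') (ψ : B →⋆ₙₐ[ℂ] B') :
    ∃ θ : MinTensor A B →⋆ₙₐ[ℂ] MinTensor A' B',
      ∀ a b, θ (minTmul a b) = minTmul (φ a) (ψ b) :=
  exists_minTensor_hom (fun x => minTmul (φ x.1) (ψ x.2)) (by simp [minTmul_mul])
    (by simp [star_minTmul, map_star])
    (fun i : (A' →L[ℂ] ℂ) × (B' →L[ℂ] ℂ) => i.1 ∘L φ.toCLM) (fun i => i.2 ∘L ψ.toCLM)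
    (fun i => prodFun i.1 i.2) (by simp)
    fun y hy => eq_zero_of_prodFun_eq_zero fun f g => hy (f, g)

/-- The slice map of a character is a `*`-homomorphism. -/
theorem exists_minTensor_slice (ε : B →⋆ₙₐ[ℂ] ℂ) :
    ∃ θ : MinTensor A B →⋆ₙₐ[ℂ] A, ∀ a b, θ (minTmul a b) = ε b • a :=
  exists_minTensor_hom (fun x => ε x.2 • x.1)
    (by simp [smul_mul_smul_comm]) (by simp [map_star])
    (fun f : A →L[ℂ] ℂ => f) (fun _ => ε.toCLM) (fun f => f) (by simp [mul_comm])
    fun y hy => eq_zero_of_forall_dual hy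

theorem norm_minTmul_le (a : A) (b : B) : ‖minTmul a b‖ ≤ ‖a‖ * ‖b‖ :=
  lp.norm_le_of_forall_le (by positivity) fun i => norm_gnsTensorOp_le a b i

theorem continuous_minTmul_left (b : B) : Continuous fun a : A => minTmul a b :=
  AddMonoidHomClass.continuous_of_bound
    (AddMonoidHom.mk' (fun a : A => minTmul a b) fun a a' => minTmul_add_left a a' b) ‖b‖
    fun a => (norm_minTmul_le a b).trans_eq (mul_comm _ _)

/-- For fixed c the map x ↦ x ⊗ c is continuous, so x may be taken in the dense algebraic tensor
product. -/
theorem cstarGen_minTmul_minTmul (A : Type*) (B : Type*) (C : Type*) [NonUnitalCStarAlgebra A]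
    [NonUnitalCStarAlgebra B] [NonUnitalCStarAlgebra C] :
    cstarGen (Set.range fun x : A × B × C => minTmul (minTmul x.1 x.2.1) x.2.2) = ⊤ := by
  rw [eq_top_iff, ← cstarGen_minTmul]
  refine cstarGen_le (cstarGen_isClosed _) ?_
  rintro _ ⟨⟨x, c⟩, rfl⟩
  refine denseRange_minMk.induction_on (p := fun x => minTmul x c ∈ cstarGen _) x
    ((cstarGen_isClosed _).preimage (continuous_minTmul_left c)) fun s => ?_
  induction s with
  | zero =>
    have : minTmul (0 : MinTensor A B) c = 0 := by
      simpa using minTmul_smul_left 0 (0 : MinTensor A B) c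
    rw [map_zero, this]
    exact zero_mem _
  | tmul a b => exact mem_cstarGen ⟨(a, b, c), rfl⟩
  | add s t hs ht =>
    rw [map_add, minTmul_add_left]
    exact add_mem hs ht

/-- Associativity of the minimal tensor product. -/
theorem exists_minTensor_assoc (A : Type*) (B : Type*) (C : Type*) [NonUnitalCStarAlgebra A]
    [NonUnitalCStarAlgebra B] [NonUnitalCStarAlgebra C] :
    ∃ θ : MinTensor (MinTensor A B) C →⋆ₙₐ[ℂ] MinTensor A (MinTensor B C),
      ∀ a b c, θ (minTmul (minTmul a b) c) = minTmul a (minTmul b c) := by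
  obtain ⟨φ, hφ⟩ := exists_hom_of_generators
    (fun x : A × B × C => minTmul (minTmul x.1 x.2.1) x.2.2)
    (fun x : A × B × C => minTmul x.1 (minTmul x.2.1 x.2.2))
    (by simp [minTmul_mul]) (by simp [star_minTmul]) (by simp [minTmul_mul])
    (by simp [star_minTmul]) (cstarGen_minTmul_minTmul A B C)
    (fun i : (A →L[ℂ] ℂ) × (B →L[ℂ] ℂ) × (C →L[ℂ] ℂ) => prodFun (prodFun i.1 i.2.1) i.2.2)
    (fun i => prodFun i.1 (prodFun i.2.1 i.2.2)) (by simp [mul_assoc])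
    -- Triple products f ⊗ (g ⊗ h) separate points: all functionals on A are paired with the
    -- separating products on B ⊗ C.
    (fun y hy => eq_zero_of_prodFun_family_eq_zero (F := fun f : A →L[ℂ] ℂ => f)
      (G := fun i : (B →L[ℂ] ℂ) × (C →L[ℂ] ℂ) => prodFun i.1 i.2)
      (fun _ => eq_zero_of_forall_dual)
      (fun _ hb => eq_zero_of_prodFun_eq_zero fun f g => hb (f, g))
      fun f i => hy (f, i.1, i.2))
  exact ⟨φ, fun a b c => hφ (a, b, c)⟩

end MinTensor

theorem minTmul_sum_left {A : Type u} [NonUnitalCStarAlgebra A] {B : Type v}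
    [NonUnitalCStarAlgebra B] {ι : Type*} (s : Finset ι) (a : ι → A) (b : B) :
    minTmul (∑ i ∈ s, a i) b = ∑ i ∈ s, minTmul (a i) b :=
  map_sum ((minMk A B).comp ((TensorProduct.mk ℂ A B).flip b)) a s

theorem minTmul_sum_right {A : Type u} [NonUnitalCStarAlgebra A] {B : Type v}
    [NonUnitalCStarAlgebra B] {ι : Type*} (s : Finset ι) (a : A) (b : ι → B) :
    minTmul a (∑ i ∈ s, b i) = ∑ i ∈ s, minTmul a (b i) :=
  map_sum ((minMk A B).comp (TensorProduct.mk ℂ A B a)) b s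

theorem minTmul_zero_left {A : Type u} [NonUnitalCStarAlgebra A] {B : Type v}
    [NonUnitalCStarAlgebra B] (b : B) : minTmul (0 : A) b = 0 :=
  map_zero ((minMk A B).comp ((TensorProduct.mk ℂ A B).flip b))

theorem minTmul_zero_right {A : Type u} [NonUnitalCStarAlgebra A] {B : Type v}
    [NonUnitalCStarAlgebra B] (a : A) : minTmul a (0 : B) = 0 :=
  map_zero ((minMk A B).comp (TensorProduct.mk ℂ A B a))

namespace MatPair

variable {N : ℕ}

/-! ## Homomorphisms of pairs -/

/-- There is a `*`-homomorphism mapping the matrix entrywise to the matrix. -/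
def Maps (X : MatPair.{u} N) (Y : MatPair.{v} N) : Prop :=
  ∃ φ : X.carrier →⋆ₙₐ[ℂ] Y.carrier, ∀ i j, φ (X.mat i j) = Y.mat i j

theorem Maps.refl (X : MatPair.{u} N) : Maps X X := ⟨NonUnitalStarAlgHom.id ℂ _, fun _ _ => rfl⟩

theorem Maps.trans {X : MatPair.{u} N} {Y : MatPair.{v} N} {Z : MatPair.{w} N}
    (h : Maps X Y) (h' : Maps Y Z) : Maps X Z := by
  obtain ⟨φ, hφ⟩ := h
  obtain ⟨ψ, hψ⟩ := h'
  exact ⟨ψ.comp φ, fun i j => by rw [NonUnitalStarAlgHom.comp_apply, hφ, hψ]⟩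

theorem Maps.wprod {X : MatPair.{u} N} {X' : MatPair.{v} N} {Y : MatPair N} {Y' : MatPair N}
    (h : Maps X X') (h' : Maps Y Y') : Maps (X.wprod Y) (X'.wprod Y') := by
  obtain ⟨φ, hφ⟩ := h
  obtain ⟨ψ, hψ⟩ := h'
  obtain ⟨θ, hθ⟩ := exists_minTensor_map φ ψ
  refine ⟨θ, fun i j => ?_⟩
  change θ (∑ k, minTmul (X.mat i k) (Y.mat k j)) = ∑ k, minTmul (X'.mat i k) (Y'.mat k j)
  simp only [map_sum, hθ, hφ, hψ]

theorem maps_wprod_assoc (X : MatPair.{u} N) (Y : MatPair.{v} N) (Z : MatPair.{w} N) :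
    Maps ((X.wprod Y).wprod Z) (X.wprod (Y.wprod Z)) := by
  obtain ⟨θ, hθ⟩ := exists_minTensor_assoc X.carrier Y.carrier Z.carrier
  refine ⟨θ, fun i j => ?_⟩
  change θ (∑ k, minTmul (∑ l, minTmul (X.mat i l) (Y.mat l k)) (Z.mat k j)) =
    ∑ l, minTmul (X.mat i l) (∑ k, minTmul (Y.mat l k) (Z.mat k j))
  simp only [minTmul_sum_left, minTmul_sum_right, map_sum, hθ]
  exact Finset.sum_comm

/-- The pair `(ℂ, 1)`. -/
def one (N : ℕ) : MatPair.{0} N where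
  carrier := ℂ
  mat := (1 : Matrix (Fin N) (Fin N) ℂ)

/-- Applying id ⊗ ε gives ∑ k, ε(y_kj) x_ik = x_ij. This provides both the transition arrows and the
left inverse of Δ. -/
theorem maps_wprod_left (X : MatPair.{u} N) {Y : MatPair.{v} N} (h : Maps Y (one N)) :
    Maps (X.wprod Y) X := by
  obtain ⟨ε, hε⟩ := h
  obtain ⟨θ, hθ⟩ := exists_minTensor_slice (A := X.carrier) (B := Y.carrier) ε
  refine ⟨θ, fun i j => ?_⟩
  change Y.carrier →⋆ₙₐ[ℂ] ℂ at ε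
  have hε' : ∀ k, ε (Y.mat k j) = if k = j then (1 : ℂ) else 0 := fun k =>
    (hε k j).trans (Matrix.one_apply (α := ℂ))
  change θ (∑ k, minTmul (X.mat i k) (Y.mat k j)) = X.mat i j
  simp [hθ, hε']

/-! ### Iterated products, powers and their counits -/

theorem Maps.wprodList_one {X : MatPair.{u} N} {l : List (MatPair.{u} N)} (h : Maps X (one N))
    (hl : ∀ Y ∈ l, Maps Y (one N)) : Maps (X.wprodList l) (one N) := by
  induction l generalizing X with
  | nil => exact h
  | cons Y l ih =>
    exact ih ((maps_wprod_left X (hl Y (by simp))).trans h) fun Z hZ => hl Z (by simp [hZ])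

theorem wpow_zero_succPNat (X : MatPair.{u} N) : X.wpow (Nat.succPNat 0) = X := rfl

theorem wpow_succ_succPNat (X : MatPair.{u} N) (n : ℕ) :
    X.wpow (n + 1).succPNat = (X.wpow n.succPNat).wprod X := by
  simp only [wpow, wprodList, Nat.natPred_succPNat, List.replicate_succ', List.foldl_append,
    List.foldl_cons, List.foldl_nil]

theorem Maps.wpow_one {X : MatPair.{u} N} (h : Maps X (one N)) (n : ℕ+) :
    Maps (X.wpow n) (one N) :=
  h.wprodList_one fun Y hY => by rwa [List.eq_of_mem_replicate hY]

/-- Powers are bracketed to the left, so splitting one needs repeated reassociation. `succPNat`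
shifts exponents by one: n + 1 and m + 1 factors make n + m + 2. -/
theorem maps_wpow_add (X : MatPair.{u} N) (n m : ℕ) :
    Maps (X.wpow (n + m + 1).succPNat) ((X.wpow n.succPNat).wprod (X.wpow m.succPNat)) := by
  induction m with
  | zero =>
    rw [wpow_zero_succPNat, Nat.add_zero, wpow_succ_succPNat]
    exact Maps.refl _
  | succ m ih =>
    rw [wpow_succ_succPNat X m, ← Nat.add_assoc, wpow_succ_succPNat X (n + m + 1)]
    exact (ih.wprod (Maps.refl X)).trans (maps_wprod_assoc _ _ _)

/-- The inclusion of the C⋆-algebra generated by the entries of the matrix. -/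
def generatedIncl (X : MatPair.{u} N) : X.generatedObj.carrier →⋆ₙₐ[ℂ] X.carrier :=
  CStarGen.incl X.entries

theorem generatedIncl_mat (X : MatPair.{u} N) (i j : Fin N) :
    X.generatedIncl (X.generatedObj.mat i j) = X.mat i j := rfl

theorem generatedIncl_injective (X : MatPair.{u} N) : Function.Injective X.generatedIncl :=
  Subtype.val_injective

theorem maps_generatedObj (X : MatPair.{u} N) : Maps X.generatedObj.toMatPair X :=
  ⟨X.generatedIncl, X.generatedIncl_mat⟩

end MatPair

/-- A homomorphism of pairs, restricted to the algebra generated by the entries of the target. -/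
def CatObj.arrowOfHom {N : ℕ} (X : CatObj.{u} N) (Y : MatPair.{v} N)
    (φ : X.carrier →⋆ₙₐ[ℂ] Y.carrier) (hφ : ∀ i j, φ (X.mat i j) = Y.mat i j) :
    CatArrow X Y.generatedObj where
  hom := NonUnitalStarAlgHom.codRestrict φ (cstarGen Y.entries) fun x => by
    have hx : x ∈ cstarGen X.entries := by rw [X.generated]; trivial
    refine map_mem_cstarGen φ ?_ hx
    rintro _ ⟨ij, rfl⟩
    rw [hφ]
    exact mem_cstarGen ⟨ij, rfl⟩
  map_mat i j := Subtype.ext (hφ i j)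

theorem MatPair.Maps.nonempty_catArrow {N : ℕ} {X : MatPair.{u} N} {Y : MatPair.{v} N}
    (h : Maps X Y) : Nonempty (CatArrow X.generatedObj Y.generatedObj) := by
  obtain ⟨φ, hφ⟩ := X.maps_generatedObj.trans h
  exact ⟨X.generatedObj.arrowOfHom Y φ hφ⟩

/-- Homomorphisms out of an object of `𝒞_N` are determined by the entries of the matrix. -/
theorem CatObj.hom_ext {N : ℕ} (X : CatObj.{u} N) {B : Type v} [NonUnitalCStarAlgebra B]
    {φ ψ : X.carrier →⋆ₙₐ[ℂ] B} (h : ∀ i j, φ (X.mat i j) = ψ (X.mat i j)) : φ = ψ := by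
  ext x
  have hx : x ∈ cstarGen X.entries := by rw [X.generated]; trivial
  exact cstarGen_hom_ext (by rintro _ ⟨ij, rfl⟩; exact h ij.1 ij.2) hx

/-! ## Magic unitaries -/

/-- The matrix is a magic unitary: its entries are projections, pairwise orthogonal in each row and
each column, and all rows and columns have the same sum. -/
structure MatPair.IsMagic {N : ℕ} (X : MatPair.{u} N) : Prop where
  star_mat : ∀ i j, star (X.mat i j) = X.mat i j
  row : ∀ i k l, X.mat i k * X.mat i l = if k = l then X.mat i k else 0
  col : ∀ i k l, X.mat k i * X.mat l i = if k = l then X.mat k i else 0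
  sum_eq : ∀ i j, ∑ k, X.mat i k = ∑ k, X.mat k j

namespace MatPair

variable {N : ℕ}

/-- The magic relations are `*`-polynomial identities in the entries, so a jointly injective family
detects them. -/
theorem IsMagic.of_jointly_injective {X : MatPair.{u} N} {ι : Type*} {Z : ι → MatPair.{v} N}
    (hZ : ∀ i, (Z i).IsMagic) (φ : ∀ i, X.carrier →⋆ₙₐ[ℂ] (Z i).carrier)
    (hφ : ∀ n i j, φ n (X.mat i j) = (Z n).mat i j)
    (hinj : ∀ x, (∀ n, φ n x = 0) → x = 0) : X.IsMagic := by
  have key : ∀ x y, (∀ n, φ n x = φ n y) → x = y := fun x y h =>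
    sub_eq_zero.mp (hinj _ fun n => by rw [map_sub, h, sub_self])
  refine ⟨fun i j => key _ _ fun n => ?_, fun i k l => key _ _ fun n => ?_,
    fun i k l => key _ _ fun n => ?_, fun i j => key _ _ fun n => ?_⟩
  · rw [map_star, hφ, (hZ n).star_mat]
  · rw [map_mul, apply_ite (φ n), map_zero, hφ, hφ, (hZ n).row]
  · rw [map_mul, apply_ite (φ n), map_zero, hφ, hφ, (hZ n).col]
  · simp only [map_sum, hφ, (hZ n).sum_eq i j]

theorem IsMagic.generatedObj {X : MatPair.{u} N} (h : X.IsMagic) :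
    X.generatedObj.toMatPair.IsMagic :=
  IsMagic.of_jointly_injective (ι := Unit) (Z := fun _ => X) (fun _ => h)
    (fun _ => X.generatedIncl) (fun _ => X.generatedIncl_mat)
    fun _ hx => (map_eq_zero_iff _ X.generatedIncl_injective).mp (hx ())

/-- In a product of two entries of one row, the rows of X kill the mixed summation indices and the
rows of Y do the rest; for columns X and Y exchange roles. Every row and column sum is the tensor of
the two common sums. -/
theorem IsMagic.wprod {X : MatPair.{u} N} {Y : MatPair.{v} N} (hX : X.IsMagic) (hY : Y.IsMagic) :
    (X.wprod Y).IsMagic where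
  star_mat i j := by
    change star (∑ k, minTmul (X.mat i k) (Y.mat k j)) = ∑ k, minTmul (X.mat i k) (Y.mat k j)
    simp only [star_sum, star_minTmul, hX.star_mat, hY.star_mat]
  row i k l := by
    have h : ∀ a b, minTmul (X.mat i a) (Y.mat a k) * minTmul (X.mat i b) (Y.mat b l) =
        if a = b then (if k = l then minTmul (X.mat i a) (Y.mat a k) else 0) else 0 := by
      intro a b
      rw [minTmul_mul, hX.row]
      split_ifs with hab hkl
      · rw [hab, hY.row, if_pos hkl]
      · rw [hab, hY.row, if_neg hkl, minTmul_zero_right]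
      all_goals exact minTmul_zero_left _
    change (∑ a, minTmul (X.mat i a) (Y.mat a k)) * (∑ b, minTmul (X.mat i b) (Y.mat b l)) =
      if k = l then ∑ a, minTmul (X.mat i a) (Y.mat a k) else 0
    simp only [Finset.sum_mul_sum, h, Finset.sum_ite_eq, Finset.mem_univ, if_true]
    split_ifs <;> simp
  col j k l := by
    have h : ∀ a b, minTmul (X.mat k a) (Y.mat a j) * minTmul (X.mat l b) (Y.mat b j) =
        if a = b then (if k = l then minTmul (X.mat k a) (Y.mat a j) else 0) else 0 := by
      intro a b
      rw [minTmul_mul, hY.col]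
      split_ifs with hab hkl
      · rw [hab, hX.col, if_pos hkl]
      · rw [hab, hX.col, if_neg hkl, minTmul_zero_left]
      all_goals exact minTmul_zero_right _
    change (∑ a, minTmul (X.mat k a) (Y.mat a j)) * (∑ b, minTmul (X.mat l b) (Y.mat b j)) =
      if k = l then ∑ a, minTmul (X.mat k a) (Y.mat a j) else 0
    simp only [Finset.sum_mul_sum, h, Finset.sum_ite_eq, Finset.mem_univ, if_true]
    split_ifs <;> simp
  sum_eq i j := by
    change ∑ k, ∑ l, minTmul (X.mat i l) (Y.mat l k) = ∑ k, ∑ l, minTmul (X.mat k l) (Y.mat l j)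
    have h1 : ∀ l, ∑ k, minTmul (X.mat i l) (Y.mat l k) =
        minTmul (X.mat i l) (∑ k, Y.mat k j) := fun l => by
      rw [← minTmul_sum_right, hY.sum_eq l j]
    have h2 : ∀ l, ∑ k, minTmul (X.mat k l) (Y.mat l j) =
        minTmul (∑ k, X.mat i k) (Y.mat l j) := fun l => by
      rw [← minTmul_sum_left, hX.sum_eq i l]
    rw [Finset.sum_comm, Finset.sum_congr rfl fun l _ => h1 l, ← minTmul_sum_left,
      Finset.sum_comm, Finset.sum_congr rfl fun l _ => h2 l, ← minTmul_sum_right]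

theorem IsMagic.wprodList {X : MatPair.{u} N} {l : List (MatPair.{u} N)} (h : X.IsMagic)
    (hl : ∀ Y ∈ l, Y.IsMagic) : (X.wprodList l).IsMagic := by
  induction l generalizing X with
  | nil => exact h
  | cons Y l ih => exact ih (h.wprod (hl Y (by simp))) fun Z hZ => hl Z (by simp [hZ])

theorem IsMagic.wpow {X : MatPair.{u} N} (h : X.IsMagic) (n : ℕ+) : (X.wpow n).IsMagic :=
  h.wprodList fun Y hY => by rwa [List.eq_of_mem_replicate hY]

theorem IsMagic.norm_mat_le {X : MatPair.{u} N} (h : X.IsMagic) (i j : Fin N) :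
    ‖X.mat i j‖ ≤ 1 :=
  IsStarProjection.norm_le (e := X.mat i j)
    ⟨(h.row i j j).trans (if_pos rfl), h.star_mat i j⟩

end MatPair

/-! ### Units and unitarity -/

theorem MatPair.IsMagic.isUnitElement {N : ℕ} {X : CatObj.{u} N} (h : X.toMatPair.IsMagic)
    (i₀ : Fin N) : IsUnitElement (∑ k, X.mat i₀ k) := by
  set e := ∑ k, X.mat i₀ k with he
  have hrow : ∀ i, ∑ k, X.mat i k = e := fun i => (h.sum_eq i i₀).trans (h.sum_eq i₀ i₀).symm
  have hstar : star e = e := by rw [he, star_sum]; simp only [h.star_mat]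
  have hl : ∀ i j, e * X.mat i j = X.mat i j := fun i j => by
    rw [← hrow i, Finset.sum_mul]; simp [h.row]
  have hr : ∀ i j, X.mat i j * e = X.mat i j := fun i j => by
    rw [← hrow i, Finset.mul_sum]; simp [h.row]
  -- The elements that e fixes from both sides form a closed `*`-subalgebra containing the entries.
  let S : NonUnitalStarSubalgebra ℂ X.carrier :=
    { carrier := {a | e * a = a ∧ a * e = a}
      add_mem' := fun {a b} ha hb => ⟨by rw [mul_add, ha.1, hb.1], by rw [add_mul, ha.2, hb.2]⟩
      zero_mem' := ⟨mul_zero _, zero_mul _⟩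
      mul_mem' := fun {a b} ha hb => ⟨by rw [← mul_assoc, ha.1], by rw [mul_assoc, hb.2]⟩
      smul_mem' := fun r a ha => ⟨by rw [mul_smul_comm, ha.1], by rw [smul_mul_assoc, ha.2]⟩
      star_mem' := fun {a} ha =>
        ⟨by rw [← hstar, ← star_mul, ha.2], by rw [← hstar, ← star_mul, ha.1]⟩ }
  have hS : IsClosed (S : Set X.carrier) :=
    (isClosed_eq (continuous_const_mul e) continuous_id).inter
      (isClosed_eq (continuous_mul_const e) continuous_id)
  intro a
  have ha : a ∈ cstarGen X.entries := by rw [X.generated]; trivial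
  exact cstarGen_le hS (by rintro _ ⟨ij, rfl⟩; exact ⟨hl _ _, hr _ _⟩) ha

theorem MatPair.IsMagic.mul_conjTranspose {N : ℕ} {X : MatPair.{u} N} (h : X.IsMagic)
    (i₀ : Fin N) :
    X.mat * X.mat.conjTranspose = Matrix.diagonal fun _ => ∑ k, X.mat i₀ k := by
  ext i j
  simp only [Matrix.mul_apply, Matrix.conjTranspose_apply, h.star_mat, h.col,
    Matrix.diagonal_apply]
  split_ifs with hij
  · rw [h.sum_eq i i₀, h.sum_eq i₀ i₀]
  · simp

theorem MatPair.IsMagic.conjTranspose_mul {N : ℕ} {X : MatPair.{u} N} (h : X.IsMagic)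
    (i₀ : Fin N) :
    X.mat.conjTranspose * X.mat = Matrix.diagonal fun _ => ∑ k, X.mat i₀ k := by
  ext i j
  simp only [Matrix.mul_apply, Matrix.conjTranspose_apply, h.star_mat, h.row,
    Matrix.diagonal_apply]
  split_ifs with hij
  · rw [h.sum_eq i₀ i]
  · simp

/-- A unit element is unique. -/
theorem IsUnitElement.eq {A : Type u} [NonUnitalCStarAlgebra A] {e e' : A}
    (h : IsUnitElement e) (h' : IsUnitElement e') : e = e' :=
  ((h' e).1.symm.trans (h e').2)

theorem IsUnitElement.minTmul {A : Type u} [NonUnitalCStarAlgebra A] {B : Type v}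
    [NonUnitalCStarAlgebra B] {e : A} {e' : B} (h : IsUnitElement e) (h' : IsUnitElement e') :
    IsUnitElement (minTmul e e') := by
  intro a
  refine denseRange_minMk.induction_on
    (p := fun a => _root_.minTmul e e' * a = a ∧ a * _root_.minTmul e e' = a) a
    ((isClosed_eq (continuous_const_mul _) continuous_id).inter
      (isClosed_eq (continuous_mul_const _) continuous_id)) fun s => ?_
  induction s with
  | zero => simp
  | tmul a b =>
    rw [minMk_tmul, minTmul_mul, minTmul_mul, (h a).1, (h a).2, (h' b).1, (h' b).2]
    exact ⟨rfl, rfl⟩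
  | add s t hs ht =>
    rw [map_add, mul_add, add_mul, hs.1, hs.2, ht.1, ht.2]
    exact ⟨rfl, rfl⟩

/-! ## Inverse limits of magic unitaries -/

section Limit

variable {N : ℕ} {D : ℕ → CatObj.{u} N}

/-- The pair of the sequences of entries in the product of C⋆-algebras. -/
def seqPair (D : ℕ → CatObj.{u} N) (hD : ∀ n, (D n).toMatPair.IsMagic) : MatPair.{u} N where
  carrier := lp (fun n => (D n).carrier) ∞
  mat i j := ⟨fun n => (D n).mat i j, memℓp_infty ⟨1, by
    rintro _ ⟨n, rfl⟩
    exact (hD n).norm_mat_le i j⟩⟩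

/-- The inverse limit of a system of magic unitaries, as a cone. -/
def limitCone (hD : ∀ n, (D n).toMatPair.IsMagic) (π : ∀ n, CatArrow (D (n + 1)) (D n)) :
    CatCone π where
  pt := (seqPair D hD).generatedObj
  arrow n :=
    { hom := (lpEval (fun n => (D n).carrier) n).comp (seqPair D hD).generatedIncl
      map_mat := fun _ _ => rfl }
  comm n a := by
    refine DFunLike.congr_fun (CatObj.hom_ext (seqPair D hD).generatedObj
      (φ := (π n).hom.comp ((lpEval (fun n => (D n).carrier) (n + 1)).comp
        (seqPair D hD).generatedIncl))
      (ψ := (lpEval (fun n => (D n).carrier) n).comp (seqPair D hD).generatedIncl) ?_) a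
    exact fun i j => (π n).map_mat i j

theorem limitCone_jointly_injective (hD : ∀ n, (D n).toMatPair.IsMagic)
    (π : ∀ n, CatArrow (D (n + 1)) (D n)) {a : (limitCone hD π).pt.carrier}
    (h : ∀ n, ((limitCone hD π).arrow n).hom a = 0) : a = 0 :=
  Subtype.ext (lp.ext (funext h))

/-- The arrows of a cone combine to a map into the product that sends entries to sequences of
entries, so it lands in the algebra these generate. -/
theorem limitCone_isInverseLimit (hD : ∀ n, (D n).toMatPair.IsMagic)
    (π : ∀ n, CatArrow (D (n + 1)) (D n)) : (limitCone hD π).IsInverseLimit := fun C =>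
  ⟨C.pt.arrowOfHom (seqPair D hD) (lpLift fun n => (C.arrow n).hom) fun i j =>
    lp.ext (funext fun n => (C.arrow n).map_mat i j), fun _ _ => rfl⟩

/-- Comparison with the concrete limit: the two comparison arrows compose to the identity because
they fix the entries. -/
theorem CatCone.IsInverseLimit.jointly_injective (hD : ∀ n, (D n).toMatPair.IsMagic)
    {π : ∀ n, CatArrow (D (n + 1)) (D n)} {C : CatCone π} (hC : C.IsInverseLimit)
    {a : C.pt.carrier} (h : ∀ n, (C.arrow n).hom a = 0) : a = 0 := by
  obtain ⟨ψ, -⟩ := hC (limitCone hD π)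
  obtain ⟨ψ', hψ'⟩ := limitCone_isInverseLimit hD π C
  have h0 : ψ'.hom a = 0 := limitCone_jointly_injective hD π fun n => by rw [hψ', h]
  have hid : ψ.hom.comp ψ'.hom = NonUnitalStarAlgHom.id ℂ C.pt.carrier :=
    CatObj.hom_ext _ fun i j => by
      rw [NonUnitalStarAlgHom.comp_apply, ψ'.map_mat, ψ.map_mat]; rfl
  have := DFunLike.congr_fun hid a
  rw [NonUnitalStarAlgHom.comp_apply, h0, map_zero] at this
  exact this.symm

end Limit

/-! ## Comultiplications -/

section Comultiplication

variable {N : ℕ}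

/-- A comultiplication exists as soon as the object is a subobject of the product of powers of a
pair. -/
theorem exists_comultiplication (X : CatObj.{u} N) (Y : MatPair.{v} N)
    (r : ∀ n : ℕ, X.carrier →⋆ₙₐ[ℂ] (Y.wpow n.succPNat).carrier)
    (hr : ∀ n i j, r n (X.mat i j) = (Y.wpow n.succPNat).mat i j)
    (hinj : ∀ x, (∀ n, r n x = 0) → x = 0) :
    ∃ Δ : X.carrier →⋆ₙₐ[ℂ] MinTensor X.carrier X.carrier,
      ∀ i j, Δ (X.mat i j) = ∑ k, minTmul (X.mat i k) (X.mat k j) := by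
  let P : ℕ → MatPair.{v} N := fun n => Y.wpow n.succPNat
  have hs : ∀ n m, ∃ s : X.carrier →⋆ₙₐ[ℂ] MinTensor (P n).carrier (P m).carrier,
      ∀ i j, s (X.mat i j) = ∑ k, minTmul ((P n).mat i k) ((P m).mat k j) := fun n m =>
    MatPair.Maps.trans ⟨r (n + m + 1), hr _⟩ (Y.maps_wpow_add n m)
  choose s hs using hs
  have hθ := fun n m => exists_minTensor_map (r n) (r m)
  choose θ hθ using hθ
  -- The graph of the desired Δ on generators. On the `*`-algebra it generates, `s n m` and r_n ⊗
  -- r_m agree, both being multiplicative.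
  let T : Set (X.carrier × MinTensor X.carrier X.carrier) :=
    Set.range fun ij : Fin N × Fin N =>
      (X.mat ij.1 ij.2, ∑ k, minTmul (X.mat ij.1 k) (X.mat k ij.2))
  have hT : ∀ i j, (X.mat i j, ∑ k, minTmul (X.mat i k) (X.mat k j)) ∈
      NonUnitalStarAlgebra.adjoin ℂ T := fun i j =>
    NonUnitalStarAlgebra.subset_adjoin ℂ _ ⟨(i, j), rfl⟩
  have hle : ∀ n m, ∀ z ∈ NonUnitalStarAlgebra.adjoin ℂ T, s n m z.1 = θ n m z.2 := by
    intro n m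
    have : NonUnitalStarAlgebra.adjoin ℂ T ≤ NonUnitalStarAlgHom.equalizer
        ((s n m).comp (NonUnitalStarAlgHom.fst ℂ X.carrier (MinTensor X.carrier X.carrier)))
        ((θ n m).comp (NonUnitalStarAlgHom.snd ℂ X.carrier (MinTensor X.carrier X.carrier))) := by
      refine NonUnitalStarAlgebra.adjoin_le ?_
      rintro _ ⟨⟨i, j⟩, rfl⟩
      change s n m (X.mat i j) = θ n m (∑ k, minTmul (X.mat i k) (X.mat k j))
      rw [hs, map_sum]
      exact Finset.sum_congr rfl fun k _ => by rw [hθ, hr, hr]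
    exact fun z hz => this hz
  -- Functionals pulled back from all levels separate the points of X, hence their products separate
  -- those of X ⊗ X.
  let Fun : Type _ := Σ n, ((P n).carrier →L[ℂ] ℂ)
  let F : Fun → X.carrier →L[ℂ] ℂ := fun f => f.2 ∘L (r f.1).toCLM
  have hF : ∀ x, (∀ f, F f x = 0) → x = 0 := fun x hx =>
    hinj x fun n => eq_zero_of_forall_dual fun f => hx ⟨n, f⟩
  have hprod : ∀ f g : Fun, prodFun (F f) (F g) = prodFun f.2 g.2 ∘L (θ f.1 g.1).toCLM :=
    fun f g => minTensor_clm_ext fun a b => by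
      simp only [prodFun_minTmul, ContinuousLinearMap.comp_apply, NonUnitalStarAlgHom.toCLM_apply,
        hθ]
      rfl
  obtain ⟨Δ, hΔ⟩ := exists_hom_of_compatible (NonUnitalStarAlgebra.adjoin ℂ T) X.generated
    (by rintro _ ⟨ij, rfl⟩; exact ⟨_, hT ij.1 ij.2⟩)
    (fun i : Fun × Fun => prodFun i.1.2 i.2.2 ∘L (s i.1.1 i.2.1).toCLM)
    (fun i => prodFun (F i.1) (F i.2))
    (fun i z hz => by
      rw [hprod, ContinuousLinearMap.comp_apply, ContinuousLinearMap.comp_apply,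
        NonUnitalStarAlgHom.toCLM_apply, NonUnitalStarAlgHom.toCLM_apply, hle _ _ z hz])
    fun y hy => eq_zero_of_prodFun_family_eq_zero hF hF fun f g => hy (f, g)
  exact ⟨Δ, fun i j => hΔ _ (hT i j)⟩

/-- A `*`-homomorphism with the comultiplication formula is unital. -/
theorem MatPair.IsMagic.isComultiplication {X : CatObj.{u} N} (h : X.toMatPair.IsMagic)
    (i₀ : Fin N) {Δ : X.carrier →⋆ₙₐ[ℂ] MinTensor X.carrier X.carrier}
    (hΔ : ∀ i j, Δ (X.mat i j) = ∑ k, minTmul (X.mat i k) (X.mat k j)) :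
    IsComultiplication X Δ where
  map_mat := hΔ
  map_unit e he := by
    have hu := h.isUnitElement i₀
    -- Δ(e) = ∑ j, ∑ k, u_ik ⊗ u_kj, and summing over j first gives ∑ k, u_ik ⊗ e = e ⊗ e.
    have hsum : Δ e = minTmul e e := by
      have hrow : ∀ i, ∑ k, X.mat i k = e := fun i =>
        ((h.sum_eq i i₀).trans (h.sum_eq i₀ i₀).symm).trans (hu.eq he)
      rw [← hrow i₀, map_sum]
      simp only [hΔ]
      rw [Finset.sum_comm]
      simp only [← minTmul_sum_right, hrow]
      rw [← minTmul_sum_left, hrow]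
    rw [hsum]
    exact he.minTmul he

theorem MatPair.IsMagic.isCompactMatrixQuantumGroup {X : CatObj.{u} N} (h : X.toMatPair.IsMagic)
    (i₀ : Fin N) {Δ : X.carrier →⋆ₙₐ[ℂ] MinTensor X.carrier X.carrier}
    (hΔ : ∀ i j, Δ (X.mat i j) = ∑ k, minTmul (X.mat i k) (X.mat k j)) :
    IsCompactMatrixQuantumGroup X := by
  -- Self-adjoint entries make the entrywise adjoint equal to u, with inverse u⋆.
  have hstar : X.mat.map star = X.mat := Matrix.ext fun i j => h.star_mat i j
  refine ⟨∑ k, X.mat i₀ k, h.isUnitElement i₀, h.mul_conjTranspose i₀, h.conjTranspose_mul i₀,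
    ⟨X.mat.conjTranspose, ?_, ?_⟩, Δ, h.isComultiplication i₀ hΔ⟩
  · rw [hstar, h.mul_conjTranspose i₀]
  · rw [hstar, h.conjTranspose_mul i₀]

/-- A comultiplication is isometric if there is a counit. -/
theorem IsComultiplication.isometry {X : CatObj.{u} N} (h : MatPair.Maps X.toMatPair (MatPair.one N))
    {Δ : X.carrier →⋆ₙₐ[ℂ] MinTensor X.carrier X.carrier} (hΔ : IsComultiplication X Δ) :
    Isometry Δ := by
  obtain ⟨θ, hθ⟩ := X.toMatPair.maps_wprod_left h
  change MinTensor X.carrier X.carrier →⋆ₙₐ[ℂ] X.carrier at θ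
  -- θ is id ⊗ ε, a left inverse of Δ.
  have hid : θ.comp Δ = NonUnitalStarAlgHom.id ℂ X.carrier := CatObj.hom_ext _ fun i j => by
    rw [NonUnitalStarAlgHom.comp_apply, hΔ.map_mat]
    exact hθ i j
  refine NonUnitalStarAlgHom.isometry Δ (Function.LeftInverse.injective (g := θ) fun x => ?_)
  exact DFunLike.congr_fun hid x

end Comultiplication

/-! ## The models -/

/-- The counit of the model over the universal C⋆-algebra generated by two projections. -/
theorem maps_matR_one {N : ℕ} (a b c d : Fin N) : (matR a b c d).Maps (MatPair.one N) := by
  -- In the representation on ℂ with p = q = 1, the off-diagonal entries 1 - p and 1 - q vanish.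
  let r : TwoProjRep :=
    { alg := ℂ, e := 1, p := 1, q := 1
      e_proj := .one _, p_proj := .one _, q_proj := .one _
      e_mul_p := one_mul _, p_mul_e := one_mul _, e_mul_q := one_mul _, q_mul_e := one_mul _ }
  let φ : TwoProj →⋆ₙₐ[ℂ] ℂ := (lpEval (fun r : TwoProjRep => r.alg) r).comp
    (CStarGen.incl (Set.range twoProjFamilyGen))
  have hu : φ TwoProj.unit = 1 := rfl
  have hp : φ TwoProj.p = 1 := rfl
  have hq : φ TwoProj.q = 1 := rfl
  refine ⟨φ, fun i j => ?_⟩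
  change φ (if i = j then if i = a ∨ i = b then TwoProj.p else
      if i = c ∨ i = d then TwoProj.q else TwoProj.unit
    else if (i = a ∧ j = b) ∨ (i = b ∧ j = a) then TwoProj.unit - TwoProj.p
    else if (i = c ∧ j = d) ∨ (i = d ∧ j = c) then TwoProj.unit - TwoProj.q
    else 0) = (1 : Matrix (Fin N) (Fin N) ℂ) i j
  rw [Matrix.one_apply]
  split_ifs <;> simp [hu, hp, hq]

/-- The universal algebra embeds in the product of all representations, so the defining relations
may be checked in each one. -/
theorem TwoProj.ext {x y : TwoProj} (h : ∀ r : TwoProjRep,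
    lpEval (fun r : TwoProjRep => r.alg) r (CStarGen.incl (Set.range twoProjFamilyGen) x) =
    lpEval (fun r : TwoProjRep => r.alg) r (CStarGen.incl (Set.range twoProjFamilyGen) y)) :
    x = y :=
  Subtype.ext (lp.ext (funext h))

/-- A projection and its complement, arranged along an involution, form a magic unitary. -/
theorem MatPair.isMagic_of_involution {N : ℕ} {X : MatPair.{u} N} {σ : Fin N → Fin N}
    (hσ : ∀ i, σ (σ i) = i) {e : X.carrier} {P : Fin N → X.carrier}
    (hP : ∀ i, IsStarProjection (P i)) (he : IsStarProjection e) (hPσ : ∀ i, P (σ i) = P i)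
    (heP : ∀ i, e * P i = P i) (hPe : ∀ i, P i * e = P i)
    (hX : ∀ i j, X.mat i j = (if i = j then P i else 0) + if j = σ i then e - P i else 0) :
    X.IsMagic := by
  -- As σ is an involution and `P` is constant on its orbits, the matrix is symmetric; columns then
  -- follow from rows.
  have hsymm : ∀ i j, X.mat i j = X.mat j i := by
    intro i j
    rw [hX, hX]
    congr 1
    · split_ifs with h1 h2 h2
      · rw [h1]
      · exact absurd h1.symm h2
      · exact absurd h2.symm h1
      · rfl
    · split_ifs with h1 h2 h2
      · rw [h1, hPσ]
      · exact absurd (by rw [h1, hσ]) h2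
      · exact absurd (by rw [h2, hσ]) h1
      · rfl
  have h1 : ∀ i, P i * P i = P i := fun i => (hP i).isIdempotentElem
  have h2 : e * e = e := he.isIdempotentElem
  have hrow : ∀ i k l, X.mat i k * X.mat i l = if k = l then X.mat i k else 0 := by
    intro i k l
    have h3 : P i * (e - P i) = 0 := by rw [mul_sub, hPe, h1, sub_self]
    have h4 : (e - P i) * P i = 0 := by rw [sub_mul, heP, h1, sub_self]
    have h5 : (e - P i) * (e - P i) = e - P i := by rw [mul_sub, h4, sub_zero, sub_mul, h2, hPe]
    rw [hX, hX, add_mul, mul_add, mul_add]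
    simp only [ite_mul, mul_ite, zero_mul, mul_zero, h1, h3, h4, h5, ite_self, add_zero, zero_add]
    by_cases hkl : k = l
    · subst hkl; simp only [if_true]; split_ifs <;> simp
    · rw [if_neg hkl]
      split_ifs
      all_goals first
        | exact add_zero _
        | exact absurd (by grind) hkl
  have hsum : ∀ i, ∑ k, X.mat i k = e := fun i => by
    simp only [hX, Finset.sum_add_distrib, Finset.sum_ite_eq, Finset.sum_ite_eq', Finset.mem_univ,
      if_true, add_sub_cancel]
  refine ⟨fun i j => ?_, hrow, fun i k l => ?_, fun i j => ?_⟩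
  · rw [hX, star_add, apply_ite star, apply_ite star, star_sub, star_zero,
      (hP i).isSelfAdjoint.star_eq, he.isSelfAdjoint.star_eq]
  · rw [hsymm k, hsymm l, hrow]
  · simp only [hsymm _ j, hsum]

theorem isMagic_matR {N : ℕ} {a b c d : Fin N} (h : [a, b, c, d].Nodup) :
    (matR a b c d).IsMagic := by
  have hunit : IsStarProjection TwoProj.unit :=
    ⟨TwoProj.ext fun r => r.e_proj.isIdempotentElem, TwoProj.ext fun r => r.e_proj.isSelfAdjoint⟩
  have hp : IsStarProjection TwoProj.p :=
    ⟨TwoProj.ext fun r => r.p_proj.isIdempotentElem, TwoProj.ext fun r => r.p_proj.isSelfAdjoint⟩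
  have hq : IsStarProjection TwoProj.q :=
    ⟨TwoProj.ext fun r => r.q_proj.isIdempotentElem, TwoProj.ext fun r => r.q_proj.isSelfAdjoint⟩
  have hep : TwoProj.unit * TwoProj.p = TwoProj.p := TwoProj.ext fun r => r.e_mul_p
  have hpe : TwoProj.p * TwoProj.unit = TwoProj.p := TwoProj.ext fun r => r.p_mul_e
  have heq : TwoProj.unit * TwoProj.q = TwoProj.q := TwoProj.ext fun r => r.e_mul_q
  have hqe : TwoProj.q * TwoProj.unit = TwoProj.q := TwoProj.ext fun r => r.q_mul_e
  have hee : TwoProj.unit * TwoProj.unit = TwoProj.unit := hunit.isIdempotentElem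
  simp only [List.nodup_cons, List.mem_cons, List.not_mem_nil, or_false, not_or, not_false_eq_true,
    List.nodup_nil, and_true] at h
  obtain ⟨⟨hab, hac, had⟩, ⟨hbc, hbd⟩, hcd⟩ := h
  let P : Fin N → TwoProj := fun i =>
    if i = a ∨ i = b then TwoProj.p else if i = c ∨ i = d then TwoProj.q else TwoProj.unit
  -- σ is (a b)(c d). At its other points `P` is the unit, so the second summand vanishes there.
  let σ : Fin N → Fin N := fun i =>
    if i = a then b else if i = b then a else if i = c then d else if i = d then c else i
  refine MatPair.isMagic_of_involution (X := matR a b c d) (σ := σ) (e := TwoProj.unit) (P := P)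
    ?_ ?_ hunit ?_ ?_ ?_ ?_
  · intro i; simp only [σ]; grind
  · intro i; change IsStarProjection (P i); simp only [P]; split_ifs <;> assumption
  · intro i; simp only [P, σ]; grind
  · intro i; change TwoProj.unit * P i = P i; simp only [P]; split_ifs <;> assumption
  · intro i; change P i * TwoProj.unit = P i; simp only [P]; split_ifs <;> assumption
  · intro i j
    change (if i = j then if i = a ∨ i = b then TwoProj.p else
        if i = c ∨ i = d then TwoProj.q else TwoProj.unit
      else if (i = a ∧ j = b) ∨ (i = b ∧ j = a) then TwoProj.unit - TwoProj.p
      else if (i = c ∧ j = d) ∨ (i = d ∧ j = c) then TwoProj.unit - TwoProj.q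
      else 0) = (if i = j then P i else 0) + if j = σ i then TwoProj.unit - P i else 0
    by_cases hij : i = j
    · subst hij
      simp only [if_true, P, σ]
      split_ifs <;> simp_all
    · rw [if_neg hij, if_neg hij, zero_add]
      simp only [P, σ]
      split_ifs <;> grind

theorem MatPair.IsMagic.modelOne {N : ℕ} (L : ℕ+) {c d : Fin N → Fin N → Fin N}
    {p₀ : Fin N × Fin N} {ps : List (Fin N × Fin N)}
    (h : ∀ p ∈ p₀ :: ps, [p.1, p.2, c p.1 p.2, d p.1 p.2].Nodup) :
    (modelOne L c d p₀ ps).toMatPair.IsMagic := by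
  refine (MatPair.IsMagic.wpow (MatPair.IsMagic.wprodList (isMagic_matR (h p₀ (by simp))) ?_)
    L).generatedObj
  intro Y hY
  obtain ⟨p, hp, rfl⟩ := List.mem_map.mp hY
  exact isMagic_matR (h p (by simp [hp]))

theorem maps_modelOne_one {N : ℕ} (L : ℕ+) (c d : Fin N → Fin N → Fin N) (p₀ : Fin N × Fin N)
    (ps : List (Fin N × Fin N)) :
    (modelOne L c d p₀ ps).toMatPair.Maps (MatPair.one N) := by
  refine (MatPair.maps_generatedObj _).trans
    (MatPair.Maps.wpow_one (MatPair.Maps.wprodList_one (maps_matR_one _ _ _ _) ?_) L)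
  intro Y hY
  obtain ⟨p, hp, rfl⟩ := List.mem_map.mp hY
  exact maps_matR_one _ _ _ _

/-- The powers of a magic unitary with a counit form an inverse system, whose limit is a compact
matrix quantum group with isometric comultiplication. -/
theorem CatObj.model_inverseLimit {N : ℕ} (i₀ : Fin N) (X : CatObj.{u} N)
    (hX : X.toMatPair.IsMagic) (hε : X.toMatPair.Maps (MatPair.one N)) :
    ∃ π : ∀ n : ℕ, CatArrow (X.model (n + 1).succPNat) (X.model n.succPNat),
      (∃ C : CatCone (D := fun n => X.model n.succPNat) π, C.IsInverseLimit) ∧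
      ∀ C : CatCone (D := fun n => X.model n.succPNat) π, C.IsInverseLimit →
        IsCompactMatrixQuantumGroup C.pt ∧
        ∀ Δ : C.pt.carrier →⋆ₙₐ[ℂ] MinTensor C.pt.carrier C.pt.carrier,
          IsComultiplication C.pt Δ → Isometry Δ := by
  -- Index n stands for the power n + 1; the counit of X slices off the last factor.
  have hπ : ∀ n : ℕ, Nonempty (CatArrow (X.model (n + 1).succPNat) (X.model n.succPNat)) :=
    fun n => MatPair.Maps.nonempty_catArrow (by
      rw [MatPair.wpow_succ_succPNat]
      exact MatPair.maps_wprod_left _ hε)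
  have hD : ∀ n : ℕ, (X.model n.succPNat).toMatPair.IsMagic := fun n => (hX.wpow _).generatedObj
  refine ⟨fun n => (hπ n).some, ⟨_, limitCone_isInverseLimit hD _⟩, fun C hC => ?_⟩
  let r : ∀ n : ℕ, C.pt.carrier →⋆ₙₐ[ℂ] (X.toMatPair.wpow n.succPNat).carrier := fun n =>
    (X.toMatPair.wpow n.succPNat).generatedIncl.comp (C.arrow n).hom
  have hr : ∀ n i j, r n (C.pt.mat i j) = (X.toMatPair.wpow n.succPNat).mat i j := fun n i j =>
    congrArg (X.toMatPair.wpow n.succPNat).generatedIncl ((C.arrow n).map_mat i j)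
  have hinj : ∀ x, (∀ n, r n x = 0) → x = 0 := fun x hx =>
    hC.jointly_injective hD fun n =>
      (map_eq_zero_iff _ (X.toMatPair.wpow n.succPNat).generatedIncl_injective).mp (hx n)
  have hmagic : C.pt.toMatPair.IsMagic :=
    MatPair.IsMagic.of_jointly_injective (fun n : ℕ => hX.wpow n.succPNat) r hr hinj
  obtain ⟨Δ, hΔ⟩ := exists_comultiplication C.pt X.toMatPair r hr hinj
  exact ⟨hmagic.isCompactMatrixQuantumGroup i₀ hΔ, fun Δ' hΔ' =>
    -- The counit of the limit is projection to the first power, followed by the counit of X.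
    hΔ'.isometry (MatPair.Maps.trans ⟨r 0, hr 0⟩ hε)⟩

end

theorem mainTheorem1 (N : ℕ) (hN : 4 ≤ N)
    (L : ℕ+)
    (hL : ∀ σ : Equiv.Perm (Fin N), ∃ l : List (Equiv.Perm (Fin N)),
      l.length ≤ L ∧ (∀ τ ∈ l, τ.IsSwap) ∧ l.prod = σ)
    (c d : Fin N → Fin N → Fin N)
    (hcd : ∀ a b : Fin N, a < b → [a, b, c a b, d a b].Nodup)
    (p₀ : Fin N × Fin N) (ps : List (Fin N × Fin N))
    (hnodup : (p₀ :: ps).Nodup)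
    (hpairs : ∀ p : Fin N × Fin N, p ∈ p₀ :: ps ↔ p.1 < p.2) :
    ∃ π : ∀ n : ℕ,
        CatArrow ((modelOne L c d p₀ ps).model (n + 1).succPNat)
          ((modelOne L c d p₀ ps).model n.succPNat),
      (∃ C : CatCone (D := fun n => (modelOne L c d p₀ ps).model n.succPNat) π,
        C.IsInverseLimit) ∧
      ∀ C : CatCone (D := fun n => (modelOne L c d p₀ ps).model n.succPNat) π,
        C.IsInverseLimit →
          IsCompactMatrixQuantumGroup C.pt ∧
          ∀ Δ : C.pt.carrier →⋆ₙₐ[ℂ] MinTensor C.pt.carrier C.pt.carrier,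
            IsComultiplication C.pt Δ → Isometry Δ :=
  -- `p₀.1` supplies an index whose row sum serves as the unit.
  CatObj.model_inverseLimit p₀.1 (modelOne L c d p₀ ps)
    (MatPair.IsMagic.modelOne L fun p hp => hcd _ _ ((hpairs p).mp hp))
    (maps_modelOne_one L c d p₀ ps)
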